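/- Let $\Bbbk$ be an algebraically closed field of characteristic zero, let $1\le n\le m$, and let $\mathfrak g^\circ=\mathfrak{sl}(n|m)$ if $n<m$ and $\mathfrak g^\circ=\mathfrak{gl}(n|n)$ if $n=m$. Put $I=\{1,\dots,n\}\cup\{1',\dots,m'\}$ and write $\varepsilon_{j'}=\delta_j$. Let $\Delta=\{\varepsilon_a-\varepsilon_b: a\ne b\in I\}$, and let $\Delta_{iso}=\{\pm(\varepsilon_i-\delta_j)\}$ be the set of isotropic roots. $\mathfrak T_{iso}$ is the groupoid with set of objects $\Delta_{iso}$ whose only non-identity morphisms are $\rho_\alpha:\alpha\to-\alpha$, $\alpha\in\Delta_{iso}$. For a set $Y$, $\mathfrak S(Y)$ is the groupoid whose objects are the subsets of $Y$ and whose morphisms $U\to V$ are the bijections. For a set $\Pi$ of simple roots and $\alpha\in\Pi$, let $r_\alpha(\Pi)$ be obtained from $\Pi$ by replacing $\alpha$ by $-\alpha$ and every other $\beta\in\Pi$ for which $\alpha+\beta$ is a root by $\alpha+\beta$. A shuffle is an ordering $\sigma=(\sigma(1),\dots,\sigma(n+m))$ of $I$ in which $1,\dots,n$ and $1',\dots,m'$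 occur in their natural order. Let $\mathfrak b^\circ(\sigma)\subset\mathfrak g^\circ$ be the Borel subalgebra containing the diagonal matrices of $\mathfrak g^\circ$ with simple roots $\Pi^\circ(\sigma)=\{\varepsilon_{\sigma(p)}-\varepsilon_{\sigma(p+1)}\}$, and let $\mathcal B^\circ=\{\mathfrak b^\circ(\sigma)\}$. Let $\nu$ act on indices, and on roots, by $i\mapsto i+1$ modulo $n$ on unprimed indices and trivially on primed ones. If $\sigma$ ends in $n$, let $\overline\sigma=(1,\nu\sigma(1),\dots,\nu\sigma(n+m-1))$. Let $\sim$ be the smallest equivalence relation on $\mathcal B^\circ\times\mathbb Z$ with $(\mathfrak b^\circ(\sigma),k)\sim(\mathfrak b^\circ(\overline\sigma),k+1)$ whenever $\sigma$ ends in $n$, and let $[\mathcal B^\circ\times\mathbb Z]$ be the set of its classes $[\mathfrak b,k]$. Let $\mathfrak g=\Bbbk[t,t^{-1}]\otimes\mathfrak g^\circ\oplus\Bbbk c\oplus\Bbbk d$ be the affinization of $\mathfrak g^\circ$ (with $[t^i\otimes x,t^j\otimes y]=t^{i+j}\otimes[x,y]+i\,\delta_{i,-j}\,\mathrm{str}(xy)\,c$,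 $c$ central, $[d,t^i\otimes x]=i\,t^i\otimes x$); if $n=m$, only $\mathfrak{sl}(n|n)$ is kept in the degrees $i\neq0$. Let $\mathfrak h$ be its Cartan subalgebra, spanned by $c$, $d$ and the diagonal matrices in $1\otimes\mathfrak g^\circ$. Let $\overline\delta\in\mathfrak h^*$ be $1$ on $d$ and $0$ on $c$ and on diagonal matrices. For $k\in\mathbb Z$ put $\eta^{(k)}_{j'}=\delta_j$ and $\eta^{(k)}_i=\varepsilon_{\nu^{-k}(i)}-\lfloor (i-1-k)/n\rfloor\,\overline\delta$. There is an embedding of $\mathfrak g^\circ$ in $\mathfrak g$ carrying diagonal matrices into $1\otimes\mathfrak h^\circ\oplus\Bbbk c$, where $\mathfrak h^\circ$ is the set of diagonal matrices in $\mathfrak g^\circ$, and the root space of $\varepsilon_a-\varepsilon_b$ onto the one of $\eta^{(k)}_a-\eta^{(k)}_b$; its image is $\mathfrak g^\circ(k)$, and $\mathfrak b^\circ(\sigma,k)$ is the image of $\mathfrak b^\circ(\sigma)$. If $\Pi$ is the set of simple roots of $\mathfrak b^\circ(\sigma,k)$ and $\theta$ is the sum of its elements, the extension of $\mathfrak b^\circ(\sigma,k)$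 to $\mathfrak g$ is the Borel subalgebra of $\mathfrak g$ with simple roots $\Pi\cup\{\overline\delta-\theta\}$. Let $\mathcal B$ be the set of all these extensions. **Theorem.** There are a bijection $e:\mathcal B\to[\mathcal B^\circ\times\mathbb Z]$ and functors $R:\mathfrak T_{iso}\to\mathfrak S(\mathcal B)$ and $B:\mathfrak T_{iso}\to\mathfrak S([\mathcal B^\circ\times\mathbb Z])$ such that: (1) $e$ sends the extension of $\mathfrak b^\circ(\sigma,k)$ to $[\mathfrak b^\circ(\sigma),k]$. (2) $R$ is given by odd reflections: $R(\alpha)$ is the set of $\mathfrak b\in\mathcal B$ that have a simple root of the form $\gamma=\alpha+s\overline\delta$, $s\in\mathbb Z$, and $R(\rho_\alpha)(\mathfrak b)$ is then the adjacent Borel subalgebra, obtained from $\mathfrak b$ by replacing the root space of $\gamma$ by that of $-\gamma$; unless $n=m=1$, its set of simple roots is $r_\gamma(\Pi)$, where $\Pi$ is the set of simple roots of $\mathfrak b$. (3) $B(\alpha)=\bigcup_{j\in\mathbb Z}\{[\mathfrak b^\circ(\sigma),j] : \nu^j\alpha\in\Pi^\circ(\sigma)\}$, and if $\nu^j\alpha\in\Pi^\circ(\sigma)$,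 then $B(\rho_\alpha)[\mathfrak b^\circ(\sigma),j]=[\mathfrak b^\circ(\sigma'),j]$, where $\sigma'$ is the shuffle with $\Pi^\circ(\sigma')=r_{\nu^j\alpha}(\Pi^\circ(\sigma))$. (4) The diagram commutes: $\mathfrak S(e)\circ R=B$, where $\mathfrak S(e):\mathfrak S(\mathcal B)\to\mathfrak S([\mathcal B^\circ\times\mathbb Z])$ is the isomorphism induced by $e$. -/

import Mathlib

open CategoryTheory

namespace AffineBorel

/-! ### Groupoids -/

/-- An object of the symmetric groupoid on `X`: a subset of `X`. -/
structure Sym (X : Type*) where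
  carrier : Set X

/-- The symmetric groupoid on `X`: morphisms from `U` to `V` are the bijections `U → V`. -/
instance Sym.instGroupoid (X : Type*) : Groupoid (Sym X) where
  Hom U V := U.carrier ≃ V.carrier
  id U := Equiv.refl U.carrier
  comp f g := Equiv.trans f g
  inv f := Equiv.symm f
  id_comp _ := Equiv.refl_trans _
  comp_id _ := Equiv.trans_refl _
  assoc _ _ _ := Equiv.trans_assoc _ _ _
  inv_comp _ := Equiv.symm_trans_self _
  comp_inv _ := Equiv.self_trans_symm _

/-- The bijection underlying the image of a morphism under a functor into a symmetric groupoid. -/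
def act {C : Type*} [Category C] {X : Type*} (F : C ⥤ Sym X) {a b : C} (f : a ⟶ b) :
    (F.obj a).carrier ≃ (F.obj b).carrier :=
  F.map f

/-- A bijection `e : X ≃ Y` transports subsets of `X` and bijections between them to `Y`. -/
def symMap {X Y : Type*} (e : X ≃ Y) : Sym X ⥤ Sym Y where
  obj U := ⟨e '' U.carrier⟩
  map {U V} f := ((e.image U.carrier).symm.trans (show U.carrier ≃ V.carrier from f)).trans
    (e.image V.carrier)
  map_id U := by
    apply Equiv.ext
    intro y
    exact (e.image U.carrier).apply_symm_apply y
  map_comp {U V W} f g := by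
    apply Equiv.ext
    intro y
    exact congrArg (fun z => (e.image W.carrier) ((show V.carrier ≃ W.carrier from g) z))
      ((e.image V.carrier).symm_apply_apply _).symm

/-! ### The root system of `gl(n|m)` and the groupoid of isotropic roots -/

/-- The index set `{1, …, n} ∪ {1', …, m'}`. -/
abbrev Idx (n m : ℕ) : Type := Fin n ⊕ Fin m

/-- `1` on unprimed and `-1` on primed indices. -/
def sgn {n m : ℕ} : Idx n m → ℤ := Sum.elim (fun _ => 1) (fun _ => -1)

/-- The difference `ε_a - ε_b`, where `ε_{j'} = δ_j`, in coordinates. -/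
def rootVec {n m : ℕ} (a b : Idx n m) : Idx n m → ℤ := Pi.single a 1 - Pi.single b 1

/-- The roots `ε_a - ε_b` with `a ≠ b`. -/
def finRoots (n m : ℕ) : Set (Idx n m → ℤ) := {α | ∃ a b, a ≠ b ∧ α = rootVec a b}

/-- The bilinear form with `(ε_i, ε_j) = δ_{ij} = -(δ_i, δ_j)`, `(ε_i, δ_j) = 0`. -/
def rootForm {n m : ℕ} (α β : Idx n m → ℤ) : ℤ := ∑ a, sgn a * α a * β a

/-- An isotropic root. -/
structure IsoRoot (n m : ℕ) where
  vec : Idx n m → ℤ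
  isRoot : vec ∈ finRoots n m
  isotropic : rootForm vec vec = 0

/-- The opposite isotropic root. -/
def IsoRoot.opp {n m : ℕ} (α : IsoRoot n m) : IsoRoot n m where
  vec := -α.vec
  isRoot := by
    obtain ⟨a, b, hab, h⟩ := α.isRoot
    exact ⟨b, a, hab.symm, by rw [h, rootVec, rootVec, neg_sub]⟩
  isotropic := by
    have h := α.isotropic
    simpa [rootForm] using h

/-- The groupoid of isotropic roots: its only morphisms are the identities and
`ρ_α : α ⟶ -α` (so there is at most one morphism between two objects). -/
instance IsoRoot.instGroupoid (n m : ℕ) : Groupoid (IsoRoot n m) where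
  Hom α β := PLift (β.vec = α.vec ∨ β.vec = -α.vec)
  id _ := ⟨Or.inl rfl⟩
  comp f g := ⟨by
    rcases f.down with h | h <;> rcases g.down with h' | h' <;> simp [h, h']⟩
  inv f := ⟨by
    rcases f.down with h | h <;> simp [h]⟩

/-- The morphism `ρ_α : α ⟶ -α`. -/
def rho {n m : ℕ} (α : IsoRoot n m) : α ⟶ α.opp := ⟨Or.inr rfl⟩

/-- The set `r_α(Π)`, for a set `Π` of simple roots in the set `Δ` of all roots:
`α` is replaced by `-α`, and every other `β` by `α + β` if this is a root. -/
def reflect {M : Type*} [AddCommGroup M] (Δ : Set M) (α : M) (S : Set M) : Set M :=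
  {γ | ∃ β ∈ S, (β = α ∧ γ = -α) ∨ (β ≠ α ∧ α + β ∈ Δ ∧ γ = α + β) ∨
    (β ≠ α ∧ α + β ∉ Δ ∧ γ = β)}

/-! ### Shuffles -/

/-- `w`, written in one-line notation, is a shuffle. -/
def IsShuffle {n m : ℕ} (w : Fin (n + m) ≃ Idx n m) : Prop :=
  (∀ i j : Fin n, i < j → w.symm (Sum.inl i) < w.symm (Sum.inl j)) ∧
  (∀ i j : Fin m, i < j → w.symm (Sum.inr i) < w.symm (Sum.inr j))

/-- The simple roots `ε_{w(i)} - ε_{w(i+1)}`. -/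
def finSimple {n m : ℕ} (w : Fin (n + m) ≃ Idx n m) : Set (Idx n m → ℤ) :=
  {α | ∃ p q : Fin (n + m), (p : ℕ) + 1 = q ∧ α = rootVec (w p) (w q)}

/-- The cyclic permutation `i ↦ i + 1` of the unprimed indices; primed indices are fixed. -/
def nu (n m : ℕ) : Equiv.Perm (Idx n m) := Equiv.sumCongr (finRotate n) (Equiv.refl _)

/-- `ν^j`, acting on roots by `ν (ε_i - δ_j) = ε_{i+1} - δ_j`, where `ε_{n+1} = ε_1`. -/
def nuRoot {n m : ℕ} (j : ℤ) (α : Idx n m → ℤ) : Idx n m → ℤ :=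
  fun a => α ((nu n m ^ (-j)) a)

/-- The last entry of `w` is `n`. -/
def EndsInN {n m : ℕ} (w : Fin (n + m) ≃ Idx n m) : Prop :=
  ∃ (p : Fin (n + m)) (i : Fin n), (p : ℕ) + 1 = n + m ∧ (i : ℕ) + 1 = n ∧ w p = Sum.inl i

/-- If `w` ends in `n`, the last entry is moved to the front and then all unprimed entries are
increased by `1` modulo `n`. -/
def rotate {n m : ℕ} (w : Fin (n + m) ≃ Idx n m) : Fin (n + m) ≃ Idx n m :=
  ((finRotate (n + m)).symm.trans w).trans (nu n m)

noncomputable section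

/-! ### The finite-dimensional Lie superalgebra and its Borel subalgebras -/

variable (𝕜 : Type*) [Field 𝕜] (n m : ℕ)

/-- Matrices with rows and columns indexed by `{1, …, n} ∪ {1', …, m'}`. -/
abbrev Mat : Type _ := Matrix (Idx n m) (Idx n m) 𝕜

variable {𝕜 n m}

/-- The supertrace. -/
def str (x : Mat 𝕜 n m) : 𝕜 := ∑ a, (sgn a : 𝕜) * x a a

/-- The even part of a matrix (the two diagonal blocks). -/
def evenPart (x : Mat 𝕜 n m) : Mat 𝕜 n m :=
  Matrix.of fun a b => if sgn a = sgn b then x a b else 0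

/-- The odd part of a matrix (the two off-diagonal blocks). -/
def oddPart (x : Mat 𝕜 n m) : Mat 𝕜 n m :=
  Matrix.of fun a b => if sgn a = sgn b then 0 else x a b

/-- The superbracket of `gl(n|m)`: the bilinear extension of `x y - (-1)^{|x||y|} y x`. -/
def superBracket (x y : Mat 𝕜 n m) : Mat 𝕜 n m :=
  x * y - (evenPart y * evenPart x + evenPart y * oddPart x + oddPart y * evenPart x
    - oddPart y * oddPart x)

variable (𝕜 n m)

/-- `sl(n|m)` if `n ≠ m`, and `gl(n|n)` if `n = m`. -/
def finAlg : Submodule 𝕜 (Mat 𝕜 n m) where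
  carrier := {x | n ≠ m → str x = 0}
  zero_mem' := by intro _; simp [str]
  add_mem' := by
    intro x y hx hy h
    have h1 := hx h
    have h2 := hy h
    simp only [str] at h1 h2 ⊢
    simp [mul_add, Finset.sum_add_distrib, h1, h2]
  smul_mem' := by
    intro c x hx h
    have h1 := hx h
    simp only [str] at h1 ⊢
    have : ∑ a, (sgn a : 𝕜) * (c • x) a a = c * ∑ a, (sgn a : 𝕜) * x a a := by
      rw [Finset.mul_sum]
      refine Finset.sum_congr rfl fun a _ => ?_
      simp only [Matrix.smul_apply, smul_eq_mul]
      ring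
    rw [this, h1, mul_zero]

variable {n m}

/-- The Borel subalgebra attached to `w`: it is spanned by the diagonal matrices it contains and
the root vectors for the roots `ε_{w(p)} - ε_{w(q)}`, `p < q`. -/
def finBorel (w : Fin (n + m) ≃ Idx n m) : Submodule 𝕜 (Mat 𝕜 n m) where
  carrier := {x | x ∈ finAlg 𝕜 n m ∧ ∀ a b, w.symm b < w.symm a → x a b = 0}
  zero_mem' := ⟨Submodule.zero_mem _, fun _ _ _ => rfl⟩
  add_mem' := by
    intro x y hx hy
    refine ⟨Submodule.add_mem _ hx.1 hy.1, fun a b h => ?_⟩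
    simp [hx.2 a b h, hy.2 a b h]
  smul_mem' := by
    intro c x hx
    refine ⟨Submodule.smul_mem _ c hx.1, fun a b h => ?_⟩
    simp [hx.2 a b h]

variable (n m)

/-- The set of Borel subalgebras attached to shuffles, i.e. those containing the diagonal matrices
and having the upper triangular matrices as their even part. -/
def finBorels : Set (Submodule 𝕜 (Mat 𝕜 n m)) := {b | ∃ w, IsShuffle w ∧ b = finBorel 𝕜 w}

variable {n m}

/-- The member of `finBorels` attached to a shuffle. -/
def shuffleBorel (w : Fin (n + m) ≃ Idx n m) (hw : IsShuffle w) : finBorels 𝕜 n m :=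
  ⟨finBorel 𝕜 w, w, hw, rfl⟩

variable (n m)

/-- The equivalence relation on pairs (Borel subalgebra, integer) generated by
`(b(w), k) ∼ (b(rotate w), k + 1)` for all shuffles `w` ending in `n`. -/
def rotSetoid : Setoid (finBorels 𝕜 n m × ℤ) :=
  Relation.EqvGen.setoid fun x y => ∃ w, IsShuffle w ∧ EndsInN w ∧
    (x.1 : Submodule 𝕜 (Mat 𝕜 n m)) = finBorel 𝕜 w ∧
    (y.1 : Submodule 𝕜 (Mat 𝕜 n m)) = finBorel 𝕜 (rotate w) ∧ y.2 = x.2 + 1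

/-- The set of equivalence classes of pairs (Borel subalgebra, integer). -/
def BorelClasses : Type _ := Quotient (rotSetoid 𝕜 n m)

variable {n m}

/-- The equivalence class `[b, k]`. -/
def borelClass (b : finBorels 𝕜 n m) (k : ℤ) : BorelClasses 𝕜 n m :=
  Quotient.mk (rotSetoid 𝕜 n m) (b, k)

/-! ### The affinization -/

variable (n m)

/-- The vector space `gl(n|m) ⊗ 𝕜[t, t⁻¹] ⊕ 𝕜 c ⊕ 𝕜 d`; the element `(x, u, v)` stands for
`∑ i, t ^ i ⊗ x i + u c + v d`. -/
abbrev Amb : Type _ := (ℤ →₀ Mat 𝕜 n m) × 𝕜 × 𝕜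

variable {𝕜 n m}

/-- The derivation `t d/dt`. -/
def eulerOp (x : ℤ →₀ Mat 𝕜 n m) : ℤ →₀ Mat 𝕜 n m :=
  x.sum fun i a => Finsupp.single i ((i : 𝕜) • a)

/-- The bracket with `[t^i ⊗ a, t^j ⊗ b] = t^{i+j} ⊗ [a, b] + i δ_{i,-j} str(a b) c`,
`[d, t^i ⊗ a] = i t^i ⊗ a`, and `c` central. -/
def affBracket (x y : Amb 𝕜 n m) : Amb 𝕜 n m :=
  ((x.1.sum fun i a => y.1.sum fun j b => Finsupp.single (i + j) (superBracket a b))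
      + x.2.2 • eulerOp y.1 - y.2.2 • eulerOp x.1,
    x.1.sum fun i a => y.1.sum fun j b => if i = -j then (i : 𝕜) * str (a * b) else 0,
    0)

variable (𝕜 n m)

/-- The affinization of `sl(n|m)` if `n ≠ m`. For `n = m` it is the subalgebra
`gl(n|n) ⊕ 𝕜 c ⊕ 𝕜 d ⊕ ⨁_{i ≠ 0} t^i ⊗ sl(n|n)`. -/
def affAlg : Submodule 𝕜 (Amb 𝕜 n m) where
  carrier := {x | ∀ i : ℤ, (n ≠ m ∨ i ≠ 0) → str (x.1 i) = 0}
  zero_mem' := by intro i _; simp [str]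
  add_mem' := by
    intro x y hx hy i h
    have h1 := hx i h
    have h2 := hy i h
    simp only [str] at h1 h2 ⊢
    simp [mul_add, Finset.sum_add_distrib, h1, h2]
  smul_mem' := by
    intro c x hx i h
    have h1 := hx i h
    simp only [str] at h1 ⊢
    have : ∑ a, (sgn a : 𝕜) * (c • x).1 i a a = c * ∑ a, (sgn a : 𝕜) * x.1 i a a := by
      rw [Finset.mul_sum]
      refine Finset.sum_congr rfl fun a _ => ?_
      simp only [Prod.smul_fst, Finsupp.smul_apply, Matrix.smul_apply, smul_eq_mul]
      ring
    rw [this, h1, mul_zero]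

/-- The Cartan subalgebra: diagonal matrices in degree `0`, together with `c` and `d`. -/
def cartan : Submodule 𝕜 (Amb 𝕜 n m) where
  carrier := {x | x ∈ affAlg 𝕜 n m ∧ ∀ (i : ℤ) (a b : Idx n m), i ≠ 0 ∨ a ≠ b → x.1 i a b = 0}
  zero_mem' := ⟨Submodule.zero_mem _, fun _ _ _ _ => rfl⟩
  add_mem' := by
    intro x y hx hy
    refine ⟨Submodule.add_mem _ hx.1 hy.1, fun i a b h => ?_⟩
    simp [hx.2 i a b h, hy.2 i a b h]
  smul_mem' := by
    intro c x hx
    refine ⟨Submodule.smul_mem _ c hx.1, fun i a b h => ?_⟩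
    simp [hx.2 i a b h]

/-- Weights: linear forms on the Cartan subalgebra. -/
abbrev Wt : Type _ := Module.Dual 𝕜 (cartan 𝕜 n m)

variable {n m}

/-- The weight `ε_a` (with `ε_{j'} = δ_j`), vanishing on `c` and `d`. -/
def eps (a : Idx n m) : Wt 𝕜 n m where
  toFun h := (h : Amb 𝕜 n m).1 0 a a
  map_add' _ _ := rfl
  map_smul' _ _ := rfl

variable (n m)

/-- The weight that is `1` on `d` and vanishes on `c` and on diagonal matrices. -/
def deltaBar : Wt 𝕜 n m where
  toFun h := (h : Amb 𝕜 n m).2.2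
  map_add' _ _ := rfl
  map_smul' _ _ := rfl

variable {n m}

/-- The weight `α + s • deltaBar`, for an integral vector `α`. -/
def affRoot (α : Idx n m → ℤ) (s : ℤ) : Wt 𝕜 n m :=
  ∑ a, α a • eps 𝕜 a + s • deltaBar 𝕜 n m

variable {𝕜}

theorem eulerOp_add (x y : ℤ →₀ Mat 𝕜 n m) : eulerOp (x + y) = eulerOp x + eulerOp y := by
  unfold eulerOp
  exact Finsupp.sum_add_index' (by simp) (by simp)

theorem eulerOp_smul (c : 𝕜) (x : ℤ →₀ Mat 𝕜 n m) : eulerOp (c • x) = c • eulerOp x := by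
  unfold eulerOp
  rw [Finsupp.sum_smul_index' (by simp), Finsupp.smul_sum]
  simp [smul_comm c]

theorem evenPart_add (x y : Mat 𝕜 n m) : evenPart (x + y) = evenPart x + evenPart y := by
  ext a b
  by_cases h : sgn a = sgn b <;> simp [evenPart, h]

theorem oddPart_add (x y : Mat 𝕜 n m) : oddPart (x + y) = oddPart x + oddPart y := by
  ext a b
  by_cases h : sgn a = sgn b <;> simp [oddPart, h]

theorem evenPart_smul (c : 𝕜) (x : Mat 𝕜 n m) : evenPart (c • x) = c • evenPart x := by
  ext a b
  by_cases h : sgn a = sgn b <;> simp [evenPart, h]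

theorem oddPart_smul (c : 𝕜) (x : Mat 𝕜 n m) : oddPart (c • x) = c • oddPart x := by
  ext a b
  by_cases h : sgn a = sgn b <;> simp [oddPart, h]

theorem superBracket_add (x y z : Mat 𝕜 n m) :
    superBracket x (y + z) = superBracket x y + superBracket x z := by
  simp only [superBracket, evenPart_add, oddPart_add]
  noncomm_ring

theorem superBracket_smul (c : 𝕜) (x y : Mat 𝕜 n m) :
    superBracket x (c • y) = c • superBracket x y := by
  simp only [superBracket, evenPart_smul, oddPart_smul, mul_smul_comm, smul_mul_assoc, smul_sub,
    smul_add]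

theorem superBracket_zero (x : Mat 𝕜 n m) : superBracket x 0 = 0 := by
  simpa using superBracket_smul (0 : 𝕜) x 0

theorem str_add (x y : Mat 𝕜 n m) : str (x + y) = str x + str y := by
  simp [str, mul_add, Finset.sum_add_distrib]

theorem str_smul (c : 𝕜) (x : Mat 𝕜 n m) : str (c • x) = c * str x := by
  simp only [str, Finset.mul_sum, Matrix.smul_apply, smul_eq_mul]
  exact Finset.sum_congr rfl fun a _ => by ring

theorem str_zero : str (0 : Mat 𝕜 n m) = 0 := by simp [str]

theorem affBracket_add (x y z : Amb 𝕜 n m) :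
    affBracket x (y + z) = affBracket x y + affBracket x z := by
  have h1 : ∀ (i : ℤ) (a : Mat 𝕜 n m),
      ((y.1 + z.1).sum fun j b => Finsupp.single (i + j) (superBracket a b))
      = (y.1.sum fun j b => Finsupp.single (i + j) (superBracket a b))
        + (z.1.sum fun j b => Finsupp.single (i + j) (superBracket a b)) := by
    intro i a
    exact Finsupp.sum_add_index' (by simp [superBracket_zero]) (by simp [superBracket_add])
  have h2 : ∀ (i : ℤ) (a : Mat 𝕜 n m),
      ((y.1 + z.1).sum fun j b => if i = -j then (i : 𝕜) * str (a * b) else 0)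
      = (y.1.sum fun j b => if i = -j then (i : 𝕜) * str (a * b) else 0)
        + (z.1.sum fun j b => if i = -j then (i : 𝕜) * str (a * b) else 0) := by
    intro i a
    refine Finsupp.sum_add_index' (by simp [str_zero]) ?_
    intro j b c
    split_ifs <;> simp [mul_add, str_add]
  refine Prod.ext ?_ (Prod.ext ?_ ?_)
  · simp only [affBracket, Prod.fst_add, Prod.snd_add, h1, Finsupp.sum_add, eulerOp_add, smul_add,
      add_smul]
    abel
  · simp only [affBracket, h2, Finsupp.sum_add, Prod.fst_add, Prod.snd_add]
  · simp [affBracket]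

theorem affBracket_smul (c : 𝕜) (x y : Amb 𝕜 n m) :
    affBracket x (c • y) = c • affBracket x y := by
  have h1 : ∀ (i : ℤ) (a : Mat 𝕜 n m),
      ((c • y.1).sum fun j b => Finsupp.single (i + j) (superBracket a b))
      = c • (y.1.sum fun j b => Finsupp.single (i + j) (superBracket a b)) := by
    intro i a
    rw [Finsupp.sum_smul_index' (by simp [superBracket_zero]), Finsupp.smul_sum]
    simp [superBracket_smul]
  have h2 : ∀ (i : ℤ) (a : Mat 𝕜 n m),
      ((c • y.1).sum fun j b => if i = -j then (i : 𝕜) * str (a * b) else 0)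
      = c • (y.1.sum fun j b => if i = -j then (i : 𝕜) * str (a * b) else 0) := by
    intro i a
    rw [Finsupp.sum_smul_index' (by simp [str_zero]), Finsupp.smul_sum]
    refine Finsupp.sum_congr fun j _ => ?_
    split_ifs
    · simp only [mul_smul_comm, str_smul, smul_eq_mul]
      ring
    · simp
  refine Prod.ext ?_ (Prod.ext ?_ ?_)
  · simp only [affBracket, Prod.smul_fst, Prod.smul_snd, h1, eulerOp_smul, smul_sub, smul_add,
      ← Finsupp.smul_sum, smul_eq_mul, mul_smul]
    rw [smul_comm x.2.2 c]
  · simp only [affBracket, Prod.smul_fst, Prod.smul_snd, h2, ← Finsupp.smul_sum]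
  · simp [affBracket]

/-- The weight space of the affinization for the weight `α`. -/
def rootSpace (α : Wt 𝕜 n m) : Submodule 𝕜 (Amb 𝕜 n m) where
  carrier := {x | x ∈ affAlg 𝕜 n m ∧
    ∀ h : cartan 𝕜 n m, affBracket (h : Amb 𝕜 n m) x = α h • x}
  zero_mem' := ⟨Submodule.zero_mem _, fun h => by
    simpa using affBracket_smul (0 : 𝕜) (h : Amb 𝕜 n m) 0⟩
  add_mem' := by
    intro x y hx hy
    exact ⟨Submodule.add_mem _ hx.1 hy.1, fun h => by
      rw [affBracket_add, hx.2 h, hy.2 h, smul_add]⟩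
  smul_mem' := by
    intro c x hx
    exact ⟨Submodule.smul_mem _ c hx.1, fun h => by
      rw [affBracket_smul, hx.2 h, smul_comm]⟩

/-- The nonzero weights of a subspace of the affinization. -/
def rootsOf (b : Submodule 𝕜 (Amb 𝕜 n m)) : Set (Wt 𝕜 n m) :=
  {α | α ≠ 0 ∧ b ⊓ rootSpace α ≠ ⊥}

/-- The simple roots of a Borel subalgebra `b` of the affinization, or of one of the subalgebras
`localAlg` below: the roots of `b` that are not sums of two roots of `b`. -/
def simpleRoots (b : Submodule 𝕜 (Amb 𝕜 n m)) : Set (Wt 𝕜 n m) :=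
  {α | α ∈ rootsOf b ∧ ∀ β ∈ rootsOf b, ∀ γ ∈ rootsOf b, α ≠ β + γ}

/-- The Borel subalgebra with set of simple roots `S`: the sum of the Cartan subalgebra and of the
root spaces for all roots that are sums of members of `S`. -/
def borelOf (S : Set (Wt 𝕜 n m)) : Submodule 𝕜 (Amb 𝕜 n m) :=
  cartan 𝕜 n m ⊔ ⨆ α ∈ rootsOf (affAlg 𝕜 n m) ∩ (AddSubmonoid.closure S : Set (Wt 𝕜 n m)),
    rootSpace α

/-- The extension to the affinization of a Borel subalgebra `b` of a subalgebra `localAlg`: the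
extending root `deltaBar - θ` is adjoined to the simple roots of `b`, where `θ` is the sum of the
simple roots of `b` (its highest root). -/
def extension (b : Submodule 𝕜 (Amb 𝕜 n m)) : Submodule 𝕜 (Amb 𝕜 n m) :=
  borelOf (insert (deltaBar 𝕜 n m - ∑ᶠ α ∈ simpleRoots b, α) (simpleRoots b))

/-- The Borel subalgebra adjacent to `b` along its simple root `γ`: the root space for `γ` is
replaced by the one for `-γ`. -/
def adjacentBorel (γ : Wt 𝕜 n m) (b : Submodule 𝕜 (Amb 𝕜 n m)) : Submodule 𝕜 (Amb 𝕜 n m) :=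
  cartan 𝕜 n m ⊔ (⨆ β ∈ rootsOf b \ {γ}, rootSpace β) ⊔ rootSpace (-γ)

/-! ### The subalgebras `localAlg k` -/

/-- The power of `t` attached to the index `a` in the `k`-th embedding: `-⌊(i - 1 - k) / n⌋` for
the unprimed index `i ∈ {1, …, n}` (below, `i` is counted from `0`), and `0` for primed ones. -/
def shift (k : ℤ) : Idx n m → ℤ :=
  Sum.elim (fun i => -(((i : ℕ) : ℤ) - k).fdiv (n : ℤ)) (fun _ => 0)

/-- The index to which `a` is sent by the `k`-th embedding: unprimed indices are decreased by `k`
modulo `n`. -/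
def globalIdx (k : ℤ) (a : Idx n m) : Idx n m := (nu n m ^ (-k)) a

variable (𝕜 n m)

/-- The `k`-th embedding of `sl(n|m)` or `gl(n|n)` into its affinization. With `a ↦ a⁻` denoting
`globalIdx k` and `s` denoting `shift k`, it sends the matrix unit `E_{ab}`, `a ≠ b`, to
`t^{s(a) - s(b)} ⊗ E_{a⁻b⁻}`, and a diagonal matrix `∑ x_a E_{aa}` to
`∑ x_a E_{a⁻a⁻} + (∑ ± s(a) x_a) c`, with the sign of `a` in the supertrace. -/
def embed (k : ℤ) : Mat 𝕜 n m →ₗ[𝕜] Amb 𝕜 n m where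
  toFun x :=
    (∑ a, ∑ b, Finsupp.single (shift k a - shift k b)
        (Matrix.single (globalIdx k a) (globalIdx k b) (x a b)),
      ∑ a, (sgn a : 𝕜) * (shift k a : 𝕜) * x a a, 0)
  map_add' x y := by
    refine Prod.ext ?_ (Prod.ext ?_ ?_)
    · simp [Matrix.single_add, Finset.sum_add_distrib]
    · simp [mul_add, Finset.sum_add_distrib]
    · simp
  map_smul' c x := by
    refine Prod.ext ?_ (Prod.ext ?_ ?_)
    · simp [Finset.smul_sum, Matrix.smul_single]
    · simp only [Matrix.smul_apply, smul_eq_mul, RingHom.id_apply, Prod.smul_snd, Prod.smul_fst,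
        Finset.mul_sum]
      exact Finset.sum_congr rfl fun a _ => by ring
    · simp

/-- The `k`-th copy of `sl(n|m)` or `gl(n|n)` in its affinization. Its roots are the
`(ε_a + s_a • deltaBar) - (ε_b + s_b • deltaBar)`, `a ≠ b`, with `s_i = ⌊(k + i - 1) / n⌋` for
unprimed and `s_{j'} = 0` for primed indices. -/
def localAlg (k : ℤ) : Submodule 𝕜 (Amb 𝕜 n m) := (finAlg 𝕜 n m).map (embed 𝕜 n m k)

/-- The Borel subalgebras `b(σ, k)` of `localAlg k`, where `σ` is a shuffle. -/
def localBorels (k : ℤ) : Set (Submodule 𝕜 (Amb 𝕜 n m)) :=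
  {b | ∃ b' ∈ finBorels 𝕜 n m, b = b'.map (embed 𝕜 n m k)}

/-- The Borel subalgebras of the affinization that are extensions of Borel subalgebras of the
subalgebras `localAlg k`, `k ∈ ℤ`. -/
def affBorels : Set (Submodule 𝕜 (Amb 𝕜 n m)) :=
  {b | ∃ k : ℤ, ∃ b' ∈ localBorels 𝕜 n m k, b = extension b'}

variable {n m}

/-- The member of `affBorels` extended from the `k`-th copy of `b`. -/
def extendFrom (b : finBorels 𝕜 n m) (k : ℤ) : affBorels 𝕜 n m :=
  ⟨extension ((b : Submodule 𝕜 (Mat 𝕜 n m)).map (embed 𝕜 n m k)), k, _, ⟨b, b.2, rfl⟩, rfl⟩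

end

end AffineBorel

/-! A Borel subalgebra of the affinization is encoded by a periodic ordering. Put N = n + m. For
positions `f`, place the symbol `ε_a - t • deltaBar` at the integer `f a + N t`; `IsPositioning`
says that every integer is taken exactly once. The height of a root is the distance between the two
symbols whose difference it is. Roots of positive height are then the positive roots, and the simple
roots are the differences of neighbours (`IsPositioning.rootsOf_borelOf`,
`IsPositioning.simpleRoots_borelOf`).

A pair `(w, k)` is a window of such an ordering: the weights `localEps k (w p)` occupy the places 0,
..., N - 1. The simple roots of the finite Borel subalgebra are the steps inside the window, and the
extending root is the step from its last symbol to the first symbol of its translate. So the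
extension is the Borel subalgebra of the whole ordering (`extension_map_embed`).

The ordering determines its positions up to a constant (`IsPositioning.sub_eq_of_heightOne_eq`), and
a rotation adds 1 to all positions (`position_rotate`), that is, it moves the window past one
unprimed symbol. Primed symbols have no shift, hence always sit in 0, ..., N - 1; two windows of the
same ordering are therefore separated only by unprimed symbols and are linked by rotations
(`borelClass_eq_of_position_add`). This gives the bijection.

An odd reflection interchanges two neighbours of opposite parity, together with all their
translates. If both lie in one window, this is the finite odd reflection of the shuffle. If they
straddle the border of the window, one of them is unprimed, and a rotation or its inverse brings
both inside (`exists_window`). The effect of an interchange on simple roots is computed once, in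
`reflect_heightOne`, with period 0 for shuffles and period N for the affinization. Reflecting twice
gives the identity, whence the functor. -/

namespace AffineBorel

/-! ### Weights of the affinization and their separation by the Cartan subalgebra -/

section Weights

variable {𝕜 : Type*} [Field 𝕜] {n m : ℕ}

theorem finsupp_sum_single_apply {V : Type*} [AddCommMonoid V] (x : ℤ →₀ V) (F : ℤ → V → V)
    (hF : ∀ i, F i 0 = 0) (i : ℤ) : (x.sum fun j b => Finsupp.single j (F j b)) i = F i (x i) := by
  classical
  rw [Finsupp.sum_apply, Finsupp.sum, Finset.sum_eq_single i]
  · simp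
  · intro j _ hj
    simp [hj]
  · intro hi
    simp [Finsupp.notMem_support_iff.1 hi, hF]

theorem superBracket_zero_left (y : Mat 𝕜 n m) : superBracket 0 y = 0 := by
  have h1 : evenPart (0 : Mat 𝕜 n m) = 0 := by simpa using evenPart_smul (0 : 𝕜) (0 : Mat 𝕜 n m)
  have h2 : oddPart (0 : Mat 𝕜 n m) = 0 := by simpa using oddPart_smul (0 : 𝕜) (0 : Mat 𝕜 n m)
  simp [superBracket, h1, h2]

theorem evenPart_add_oddPart (y : Mat 𝕜 n m) : evenPart y + oddPart y = y := by
  ext a b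
  by_cases h : sgn a = sgn b <;> simp [evenPart, oddPart, h]

theorem superBracket_diagonal (d : Idx n m → 𝕜) (y : Mat 𝕜 n m) (a b : Idx n m) :
    superBracket (Matrix.diagonal d) y a b = (d a - d b) * y a b := by
  have h1 : evenPart (Matrix.diagonal d : Mat 𝕜 n m) = Matrix.diagonal d := by
    ext a b
    by_cases h : a = b <;> simp [evenPart, h]
  have h2 : oddPart (Matrix.diagonal d : Mat 𝕜 n m) = 0 := by
    ext a b
    by_cases h : a = b <;> simp [oddPart, h]
  rw [superBracket, h1, h2]
  simp only [mul_zero, add_zero, sub_zero, ← add_mul, evenPart_add_oddPart]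
  rw [Matrix.sub_apply, Matrix.diagonal_mul, Matrix.mul_diagonal]
  ring

theorem eps_apply (a : Idx n m) (h : cartan 𝕜 n m) :
    eps 𝕜 a h = (h : Amb 𝕜 n m).1 0 a a := rfl

theorem deltaBar_apply (h : cartan 𝕜 n m) : deltaBar 𝕜 n m h = (h : Amb 𝕜 n m).2.2 := rfl

theorem cartan_fst (h : cartan 𝕜 n m) :
    (h : Amb 𝕜 n m).1 = Finsupp.single 0 (Matrix.diagonal fun a => eps 𝕜 a h) := by
  ext i a b
  by_cases hi : i = 0
  · subst hi
    by_cases hab : a = b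
    · subst hab
      simp [eps_apply]
    · simp [Matrix.diagonal_apply_ne _ hab, h.2.2 0 a b (Or.inr hab)]
  · rw [h.2.2 i a b (Or.inl hi), Finsupp.single_eq_of_ne hi]
    rfl

theorem affRoot_rootVec (a b : Idx n m) (s : ℤ) :
    affRoot 𝕜 (rootVec a b) s = eps 𝕜 a - eps 𝕜 b + s • deltaBar 𝕜 n m := by
  simp [affRoot, rootVec, sub_smul, Finset.sum_sub_distrib, Pi.single_apply, ite_smul]

theorem affRoot_add (v w : Idx n m → ℤ) (s t : ℤ) :
    affRoot 𝕜 v s + affRoot 𝕜 w t = affRoot 𝕜 (v + w) (s + t) := by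
  simp only [affRoot, Pi.add_apply, add_smul, Finset.sum_add_distrib]
  abel

theorem affRoot_neg (v : Idx n m → ℤ) (s : ℤ) : -affRoot 𝕜 v s = affRoot 𝕜 (-v) (-s) := by
  simp [affRoot, Finset.sum_neg_distrib, add_comm]

theorem rootVec_self (a : Idx n m) : rootVec a a = 0 := sub_self _

theorem rootVec_add (a b c : Idx n m) : rootVec a b + rootVec b c = rootVec a c :=
  sub_add_sub_cancel _ _ _

theorem rootVec_neg (a b : Idx n m) : -rootVec a b = rootVec b a := neg_sub _ _

theorem affRoot_zero : affRoot 𝕜 (0 : Idx n m → ℤ) 0 = 0 := by simp [affRoot]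

theorem affBracket_cartan_fst (h : cartan 𝕜 n m) (x : Amb 𝕜 n m) (i : ℤ) (a b : Idx n m) :
    (affBracket (h : Amb 𝕜 n m) x).1 i a b = affRoot 𝕜 (rootVec a b) i h * x.1 i a b := by
  have e1 : eulerOp (h : Amb 𝕜 n m).1 = 0 := by
    rw [cartan_fst, eulerOp, Finsupp.sum_single_index] <;> simp
  have e2 : (eulerOp x.1) i = (i : 𝕜) • x.1 i :=
    finsupp_sum_single_apply x.1 (fun i a => (i : 𝕜) • a) (by simp) i
  have e3 : ((h : Amb 𝕜 n m).1.sum fun i a => x.1.sum fun j b =>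
      Finsupp.single (i + j) (superBracket a b)) i
      = superBracket (Matrix.diagonal fun a => eps 𝕜 a h) (x.1 i) := by
    rw [cartan_fst, Finsupp.sum_single_index]
    · simp only [zero_add]
      exact finsupp_sum_single_apply x.1 (fun _ b => superBracket _ b)
        (fun _ => superBracket_zero _) i
    · simp [superBracket_zero_left]
  rw [affBracket, e1, smul_zero, sub_zero, Finsupp.add_apply, e3, Finsupp.smul_apply, e2,
    Matrix.add_apply, superBracket_diagonal, affRoot_rootVec]
  simp [deltaBar]
  ring

theorem affBracket_cartan_snd (h : cartan 𝕜 n m) (x : Amb 𝕜 n m) :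
    (affBracket (h : Amb 𝕜 n m) x).2 = 0 := by
  refine Prod.ext ?_ rfl
  change ((h : Amb 𝕜 n m).1.sum fun i a => x.1.sum fun j b =>
    if i = -j then (i : 𝕜) * str (a * b) else 0) = 0
  rw [cartan_fst, Finsupp.sum_single_index] <;> simp [str_zero]

/-- Weight vectors are characterized by their coordinates. -/
theorem mem_rootSpace_iff (α : Wt 𝕜 n m) (x : Amb 𝕜 n m) :
    x ∈ rootSpace α ↔ x ∈ affAlg 𝕜 n m ∧
      (∀ i a b, x.1 i a b ≠ 0 → affRoot 𝕜 (rootVec a b) i = α) ∧ (x.2 ≠ 0 → α = 0) := by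
  constructor
  · rintro ⟨hx, h⟩
    refine ⟨hx, fun i a b hne => ?_, fun hne => ?_⟩
    · ext z
      have := congrArg (fun y : Amb 𝕜 n m => y.1 i a b) (h z)
      simp only [affBracket_cartan_fst] at this
      exact mul_right_cancel₀ hne this
    · ext z
      have := congrArg (fun y : Amb 𝕜 n m => y.2) (h z)
      simp only [affBracket_cartan_snd] at this
      rcases smul_eq_zero.1 (show α z • x.2 = 0 from this.symm) with h | h
      · exact h
      · exact absurd h hne
  · rintro ⟨hx, h1, h2⟩
    refine ⟨hx, fun z => Prod.ext ?_ ?_⟩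
    · ext i a b
      rw [affBracket_cartan_fst]
      by_cases hne : x.1 i a b = 0
      · simp [hne]
      · rw [h1 i a b hne]
        rfl
    · rw [affBracket_cartan_snd]
      by_cases hne : x.2 = 0
      · simp [hne]
      · simp [h2 hne]

theorem sum_sgn : ∑ a : Idx n m, sgn a = (n : ℤ) - m := by
  simp [sgn, sub_eq_add_neg]

/-- Integral functionals on the root lattice are evaluations at elements of the Cartan
subalgebra. -/
theorem exists_cartan_eval [CharZero 𝕜] (f : Idx n m → ℤ) (N : ℤ) : ∃ h : cartan 𝕜 n m,
    ∀ a b s, affRoot 𝕜 (rootVec a b) s h = ((f b - f a + N * s : ℤ) : 𝕜) := by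
  -- Root values see only differences of diagonal entries, so a scalar matrix may be added. Its
  -- supertrace is `c (n - m)`, which can correct the supertrace when `n ≠ m`; for `n = m` no
  -- correction is required.
  obtain ⟨c, hc⟩ : ∃ c : 𝕜, n ≠ m → ∑ a : Idx n m, (sgn a : 𝕜) * (c - (f a : 𝕜)) = 0 := by
    by_cases hnm : n = m
    · exact ⟨0, fun h => absurd hnm h⟩
    · have h0 : ((n : 𝕜) - m) ≠ 0 := by
        rw [sub_ne_zero]
        exact_mod_cast hnm
      refine ⟨(∑ a : Idx n m, (sgn a : 𝕜) * (f a : 𝕜)) / ((n : 𝕜) - m), fun _ => ?_⟩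
      have h1 : ∑ a : Idx n m, (sgn a : 𝕜) = (n : 𝕜) - m := by
        have := congrArg (Int.cast : ℤ → 𝕜) (sum_sgn (n := n) (m := m))
        push_cast at this
        exact this
      simp only [mul_sub, Finset.sum_sub_distrib, ← Finset.sum_mul, h1]
      field_simp
      ring
  let x : Amb 𝕜 n m := (Finsupp.single 0 (Matrix.diagonal fun a => c - (f a : 𝕜)), 0, (N : 𝕜))
  have hx : x ∈ cartan 𝕜 n m := by
    refine ⟨fun i hi => ?_, fun i a b hi => ?_⟩
    · by_cases h0 : i = 0
      · subst h0
        simpa [x, str] using hc (by simpa using hi)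
      · simp only [x, Finsupp.single_eq_of_ne h0, str_zero]
    · by_cases h0 : i = 0
      · subst h0
        simp only [x, Finsupp.single_eq_same]
        exact Matrix.diagonal_apply_ne _ (by simpa using hi)
      · simp only [x, Finsupp.single_eq_of_ne h0]
        rfl
  refine ⟨⟨x, hx⟩, fun a b s => ?_⟩
  rw [affRoot_rootVec]
  simp [eps_apply, deltaBar_apply, x]
  ring

/-- Replaces comparison of coefficients: for `n ≠ m` the vanishing supertrace is a linear relation
between the `eps`, so the coefficients of a weight are not well defined, but integral functionals on
differences are. Characteristic zero turns the equality in `𝕜` into one in `ℤ`. -/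
theorem affRoot_separates [CharZero 𝕜] {a b u v : Idx n m} {s t : ℤ}
    (h : affRoot 𝕜 (rootVec a b) s = affRoot 𝕜 (rootVec u v) t) (f : Idx n m → ℤ) (N : ℤ) :
    f b - f a + N * s = f v - f u + N * t := by
  obtain ⟨z, hz⟩ := exists_cartan_eval (𝕜 := 𝕜) f N
  have := congrArg (fun w : Wt 𝕜 n m => w z) h
  simp only [hz] at this
  exact_mod_cast this

theorem affRoot_add_separates [CharZero 𝕜] {a b c d u v : Idx n m} {r s t : ℤ}
    (h : affRoot 𝕜 (rootVec a b) s + affRoot 𝕜 (rootVec c d) t = affRoot 𝕜 (rootVec u v) r)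
    (f : Idx n m → ℤ) (N : ℤ) :
    (f b - f a + N * s) + (f d - f c + N * t) = f v - f u + N * r := by
  obtain ⟨z, hz⟩ := exists_cartan_eval (𝕜 := 𝕜) f N
  have := congrArg (fun w : Wt 𝕜 n m => w z) h
  simp only [hz, LinearMap.add_apply] at this
  exact_mod_cast this

theorem affRoot_ne_zero_iff [CharZero 𝕜] {a b : Idx n m} {s : ℤ} :
    affRoot 𝕜 (rootVec a b) s ≠ 0 ↔ a ≠ b ∨ s ≠ 0 := by
  classical
  constructor
  · contrapose!
    rintro ⟨rfl, rfl⟩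
    rw [rootVec_self, affRoot_zero]
  · rintro h h0
    rw [← affRoot_zero, ← rootVec_self a] at h0
    have h1 := affRoot_separates h0 0 1
    have h2 := affRoot_separates h0 (Pi.single a 1) 0
    rcases h with h | h
    · simp [h.symm] at h2
    · simp at h1
      exact h h1

theorem affRoot_pair_injective [CharZero 𝕜] {a b u v : Idx n m} {s t : ℤ} (hab : a ≠ b)
    (h : affRoot 𝕜 (rootVec a b) s = affRoot 𝕜 (rootVec u v) t) : a = u ∧ b = v ∧ s = t := by
  classical
  have h1 := affRoot_separates h 0 1
  have h2 := affRoot_separates h (Pi.single a 1) 0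
  have h3 := affRoot_separates h (Pi.single b 1) 0
  simp only [Pi.single_apply, hab, hab.symm, if_true, if_false] at h2 h3
  refine ⟨?_, ?_, by simpa using h1⟩
  · by_contra hu
    rw [if_neg (Ne.symm hu)] at h2
    split_ifs at h2 <;> omega
  · by_contra hu
    rw [if_neg (Ne.symm hu)] at h3
    split_ifs at h3 <;> omega

end Weights

/-! ### Periodic orderings and heights of weights -/

section Heights

variable {n m : ℕ}

/-- The height of the weight `ε_a - ε_b + s • deltaBar` with respect to the positions `f`. -/
def height (f : Idx n m → ℤ) (a b : Idx n m) (s : ℤ) : ℤ := f b - f a + ((n : ℤ) + m) * s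

/-- The positions `f a + (n + m) t` exhaust the integers, each being taken once. -/
structure IsPositioning (f : Idx n m → ℤ) : Prop where
  surj : ∀ z : ℤ, ∃ a t, f a + ((n : ℤ) + m) * t = z
  inj : ∀ a b t, f a = f b + ((n : ℤ) + m) * t → a = b

variable (𝕜 : Type*) [Field 𝕜]

/-- The weights of height one. -/
def heightOne (f : Idx n m → ℤ) : Set (Wt 𝕜 n m) :=
  {α | ∃ a b s, height f a b s = 1 ∧ α = affRoot 𝕜 (rootVec a b) s}

/-- The weights of positive height. -/
def heightPos (f : Idx n m → ℤ) : Set (Wt 𝕜 n m) :=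
  {α | ∃ a b s, 0 < height f a b s ∧ α = affRoot 𝕜 (rootVec a b) s}

variable {𝕜}

theorem height_add (f : Idx n m → ℤ) (a b c : Idx n m) (s t : ℤ) :
    height f a b s + height f b c t = height f a c (s + t) := by
  unfold height
  ring

theorem affRoot_rootVec_add (a b c : Idx n m) (s t : ℤ) :
    affRoot 𝕜 (rootVec a b) s + affRoot 𝕜 (rootVec b c) t = affRoot 𝕜 (rootVec a c) (s + t) := by
  rw [affRoot_add, rootVec_add]

theorem IsPositioning.exists_succ {f : Idx n m → ℤ} (hf : IsPositioning f) (a : Idx n m) :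
    ∃ c t, height f a c t = 1 := by
  obtain ⟨c, t, h⟩ := hf.surj (f a + 1)
  exact ⟨c, t, by unfold height; linarith⟩

theorem IsPositioning.height_ne_zero {f : Idx n m → ℤ} (hf : IsPositioning f) {a b : Idx n m}
    {s : ℤ} (h : a ≠ b ∨ s ≠ 0) : height f a b s ≠ 0 := by
  intro h0
  have hab : b = a := hf.inj b a (-s) (by unfold height at h0; linarith)
  subst hab
  have hN : (0 : ℤ) < (n : ℤ) + m := by
    rcases b with i | i
    · have := i.pos; omega
    · have := i.pos; omega
  rcases h with h | h
  · exact h rfl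
  · simp only [height, sub_self, zero_add] at h0
    rcases mul_eq_zero.1 h0 with h1 | h1
    · omega
    · exact h h1

/-- Walk along the ordering from the first symbol of the difference to the second; each step to the
next symbol contributes a weight of height one. -/
theorem IsPositioning.mem_closure {f : Idx n m → ℤ} (hf : IsPositioning f) (h : ℕ) :
    ∀ (a b : Idx n m) (s : ℤ), height f a b s = h →
      affRoot 𝕜 (rootVec a b) s ∈ AddSubmonoid.closure (heightOne 𝕜 f) := by
  induction h with
  | zero =>
    intro a b s h0
    by_cases hc : a ≠ b ∨ s ≠ 0
    · exact absurd h0 (hf.height_ne_zero hc)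
    · push Not at hc
      obtain ⟨rfl, rfl⟩ := hc
      rw [rootVec_self, affRoot_zero]
      exact AddSubmonoid.zero_mem _
  | succ h ih =>
    intro a b s hs
    obtain ⟨c, t, hc⟩ := hf.exists_succ a
    have h1 := height_add f a c b t (s - t)
    rw [add_sub_cancel] at h1
    rw [← add_sub_cancel t s, ← affRoot_rootVec_add a c b]
    refine AddSubmonoid.add_mem _ (AddSubmonoid.subset_closure ⟨a, c, t, hc, rfl⟩) (ih _ _ _ ?_)
    push_cast at hs
    linarith

variable [CharZero 𝕜]

theorem height_congr {a b u v : Idx n m} {s t : ℤ}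
    (h : affRoot 𝕜 (rootVec a b) s = affRoot 𝕜 (rootVec u v) t) (f : Idx n m → ℤ) :
    height f a b s = height f u v t := affRoot_separates h f _

theorem ne_zero_of_height_ne_zero {f : Idx n m → ℤ} {a b : Idx n m} {s : ℤ}
    (h : height f a b s ≠ 0) : affRoot 𝕜 (rootVec a b) s ≠ 0 := by
  rw [affRoot_ne_zero_iff]
  by_contra! hc
  obtain ⟨rfl, rfl⟩ := hc
  simp [height] at h

theorem mem_heightOne_iff {f : Idx n m → ℤ} {a b : Idx n m} {s : ℤ} :
    affRoot 𝕜 (rootVec a b) s ∈ heightOne 𝕜 f ↔ height f a b s = 1 := by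
  constructor
  · rintro ⟨u, v, t, h, he⟩
    rwa [height_congr he]
  · exact fun h => ⟨a, b, s, h, rfl⟩

theorem mem_heightPos_iff {f : Idx n m → ℤ} {a b : Idx n m} {s : ℤ} :
    affRoot 𝕜 (rootVec a b) s ∈ heightPos 𝕜 f ↔ 0 < height f a b s := by
  constructor
  · rintro ⟨u, v, t, h, he⟩
    rwa [height_congr he]
  · exact fun h => ⟨a, b, s, h, rfl⟩

/-- The height is evaluation at one element of the Cartan subalgebra, hence additive; every
generator has the value 1, so every sum has a natural number as its value. -/
theorem height_nonneg_of_mem_closure {f : Idx n m → ℤ} {a b : Idx n m} {s : ℤ}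
    (h : affRoot 𝕜 (rootVec a b) s ∈ AddSubmonoid.closure (heightOne 𝕜 f)) :
    0 ≤ height f a b s := by
  obtain ⟨z, hz⟩ := exists_cartan_eval (𝕜 := 𝕜) f ((n : ℤ) + m)
  have key : ∀ α ∈ AddSubmonoid.closure (heightOne 𝕜 f), ∃ k : ℕ, α z = (k : 𝕜) := by
    intro α hα
    induction hα using AddSubmonoid.closure_induction with
    | mem x hx =>
      obtain ⟨a, b, s, h1, rfl⟩ := hx
      refine ⟨1, ?_⟩
      unfold height at h1
      rw [hz, h1]
      simp
    | zero => exact ⟨0, by simp⟩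
    | add x y _ _ hx hy =>
      obtain ⟨k, hk⟩ := hx
      obtain ⟨l, hl⟩ := hy
      exact ⟨k + l, by simp [hk, hl]⟩
  obtain ⟨k, hk⟩ := key _ h
  rw [hz] at hk
  have : f b - f a + ((n : ℤ) + m) * s = k := by exact_mod_cast hk
  unfold height
  omega

end Heights

/-! ### Roots and simple roots of the Borel subalgebra of a periodic ordering -/

section Roots

variable {𝕜 : Type*} [Field 𝕜] {n m : ℕ}

theorem single_mem_affAlg {a b : Idx n m} (hab : a ≠ b) (i : ℤ) (c : 𝕜) :
    ((Finsupp.single i (Matrix.single a b c), 0, 0) : Amb 𝕜 n m) ∈ affAlg 𝕜 n m := by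
  intro j _
  by_cases h : j = i
  · subst h
    simp only [Finsupp.single_eq_same, str]
    refine Finset.sum_eq_zero fun d _ => ?_
    rw [Matrix.single_apply_of_ne, mul_zero]
    rintro ⟨rfl, rfl⟩
    exact hab rfl
  · simp only [Finsupp.single_eq_of_ne h, str_zero]

theorem single_mem_rootSpace {a b : Idx n m} (hab : a ≠ b) (i : ℤ) (c : 𝕜) :
    ((Finsupp.single i (Matrix.single a b c), 0, 0) : Amb 𝕜 n m) ∈
      rootSpace (affRoot 𝕜 (rootVec a b) i) := by
  rw [mem_rootSpace_iff]
  refine ⟨single_mem_affAlg hab i c, fun j u v hne => ?_, fun h => absurd rfl h⟩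
  simp only at hne
  by_cases h : j = i
  · subst h
    rw [Finsupp.single_eq_same] at hne
    by_cases huv : a = u ∧ b = v
    · rw [huv.1, huv.2]
    · exact absurd (Matrix.single_apply_of_ne _ _ _ _ _ huv) hne
  · rw [Finsupp.single_eq_of_ne h] at hne
    exact absurd rfl hne

variable [CharZero 𝕜]

theorem rootsOf_affAlg (hn : 1 ≤ n) (hm : 1 ≤ m) : rootsOf (affAlg 𝕜 n m) =
    {α | α ≠ 0 ∧ ∃ a b s, α = affRoot 𝕜 (rootVec a b) s} := by
  ext α
  constructor
  · rintro ⟨h0, h⟩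
    refine ⟨h0, ?_⟩
    obtain ⟨x, ⟨_, hx⟩, hne⟩ := Submodule.exists_mem_ne_zero_of_ne_bot h
    replace hx := (mem_rootSpace_iff _ _).1 hx
    have h2 : x.2 = 0 := by
      by_contra hc
      exact h0 (hx.2.2 hc)
    by_contra! hc
    refine hne (Prod.ext ?_ h2)
    ext i a b
    by_contra hne'
    exact hc a b i (hx.2.1 i a b hne').symm
  · rintro ⟨h0, a, b, s, rfl⟩
    refine ⟨h0, (Submodule.ne_bot_iff _).2 ?_⟩
    by_cases hab : a = b
    · subst hab
      -- The matrix `E_{11} + E_{1'1'}` has supertrace zero, so it survives in every degree even if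
      -- `n = m`, and gives a vector for each imaginary root.
      let d : Idx n m → 𝕜 := fun c =>
        if c = Sum.inl ⟨0, hn⟩ then 1 else if c = Sum.inr ⟨0, hm⟩ then 1 else 0
      have hd : str (Matrix.diagonal d) = 0 := by
        simp [str, d, sgn]
      let x : Amb 𝕜 n m := (Finsupp.single s (Matrix.diagonal d), 0, 0)
      have hx : x ∈ affAlg 𝕜 n m := by
        intro j _
        by_cases h : j = s
        · subst h
          simpa [x] using hd
        · simp only [x, Finsupp.single_eq_of_ne h, str_zero]
      refine ⟨x, ⟨hx, (mem_rootSpace_iff _ _).2 ⟨hx, fun j u v hne => ?_, fun h => absurd rfl h⟩⟩,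
        fun hc => ?_⟩
      · by_cases h : j = s
        · subst h
          simp only [x, Finsupp.single_eq_same] at hne
          by_cases huv : u = v
          · rw [huv, rootVec_self, rootVec_self]
          · exact absurd (Matrix.diagonal_apply_ne _ huv) hne
        · simp only [x, Finsupp.single_eq_of_ne h] at hne
          exact absurd rfl hne
      · have := congrArg (fun y : Amb 𝕜 n m => y.1 s (Sum.inl ⟨0, hn⟩) (Sum.inl ⟨0, hn⟩)) hc
        simp [x, d] at this
    · refine ⟨_, ⟨single_mem_affAlg hab s 1, single_mem_rootSpace hab s 1⟩, fun hc => ?_⟩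
      have := congrArg (fun y : Amb 𝕜 n m => y.1 s a b) hc
      simp at this

theorem affRoot_mem_rootsOf (hn : 1 ≤ n) (hm : 1 ≤ m) {a b : Idx n m} {s : ℤ}
    (h : a ≠ b ∨ s ≠ 0) : affRoot 𝕜 (rootVec a b) s ∈ rootsOf (affAlg 𝕜 n m) := by
  rw [rootsOf_affAlg hn hm]
  exact ⟨affRoot_ne_zero_iff.2 h, a, b, s, rfl⟩

theorem IsPositioning.roots_inter_closure (hn : 1 ≤ n) (hm : 1 ≤ m) {f : Idx n m → ℤ}
    (hf : IsPositioning f) :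
    rootsOf (affAlg 𝕜 n m) ∩ (AddSubmonoid.closure (heightOne 𝕜 f) : Set (Wt 𝕜 n m)) =
      heightPos 𝕜 f := by
  ext α
  constructor
  · rintro ⟨h1, h2⟩
    rw [rootsOf_affAlg hn hm] at h1
    obtain ⟨h0, a, b, s, rfl⟩ := h1
    refine ⟨a, b, s, lt_of_le_of_ne (height_nonneg_of_mem_closure h2) (Ne.symm ?_), rfl⟩
    exact hf.height_ne_zero (affRoot_ne_zero_iff.1 h0)
  · rintro ⟨a, b, s, h, rfl⟩
    obtain ⟨k, hk⟩ := Int.eq_ofNat_of_zero_le h.le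
    refine ⟨?_, hf.mem_closure k a b s hk⟩
    rw [rootsOf_affAlg hn hm]
    exact ⟨ne_zero_of_height_ne_zero h.ne', a, b, s, rfl⟩

/-- The Borel subalgebra with positive roots the weights of positive height. -/
theorem IsPositioning.borelOf_eq (hn : 1 ≤ n) (hm : 1 ≤ m) {f : Idx n m → ℤ}
    (hf : IsPositioning f) :
    borelOf (heightOne 𝕜 f) = cartan 𝕜 n m ⊔ ⨆ α ∈ heightPos 𝕜 f, rootSpace α := by
  rw [borelOf, hf.roots_inter_closure hn hm]

/-- A sum of root spaces might a priori meet further root spaces. This coordinate test excludes it: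
each summand, and hence the whole Borel subalgebra, lies in the kernel of every coordinate of
negative height. -/
theorem coord_eq_zero_of_mem_borelOf (hn : 1 ≤ n) (hm : 1 ≤ m) {f : Idx n m → ℤ}
    (hf : IsPositioning f) {x : Amb 𝕜 n m} (hx : x ∈ borelOf (heightOne 𝕜 f)) (i : ℤ)
    (a b : Idx n m) (h : height f a b i < 0) : x.1 i a b = 0 := by
  let E : Submodule 𝕜 (Amb 𝕜 n m) :=
    { carrier := {x | x.1 i a b = 0}
      zero_mem' := rfl
      add_mem' := by
        intro x y hx hy
        have h1 : x.1 i a b = 0 := hx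
        have h2 : y.1 i a b = 0 := hy
        simp [h1, h2]
      smul_mem' := by
        intro c x hx
        have h1 : x.1 i a b = 0 := hx
        simp [h1] }
  suffices hE : borelOf (heightOne 𝕜 f) ≤ E from hE hx
  rw [hf.borelOf_eq hn hm]
  refine sup_le (fun y hy => hy.2 i a b ?_) (iSup₂_le fun α hα y hy => ?_)
  · by_contra! hc
    obtain ⟨rfl, rfl⟩ := hc
    simp [height] at h
  · change y.1 i a b = 0
    by_contra hne
    have h1 := ((mem_rootSpace_iff _ _).1 hy).2.1 i a b hne
    rw [← h1, mem_heightPos_iff] at hα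
    omega

theorem IsPositioning.rootsOf_borelOf (hn : 1 ≤ n) (hm : 1 ≤ m) {f : Idx n m → ℤ}
    (hf : IsPositioning f) : rootsOf (borelOf (heightOne 𝕜 f)) = heightPos 𝕜 f := by
  ext α
  constructor
  · rintro ⟨h0, h⟩
    obtain ⟨x, ⟨hxb, hx⟩, hne⟩ := Submodule.exists_mem_ne_zero_of_ne_bot h
    replace hx := (mem_rootSpace_iff _ _).1 hx
    have h2 : x.2 = 0 := by
      by_contra hc
      exact h0 (hx.2.2 hc)
    by_contra hα
    refine hne (Prod.ext ?_ h2)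
    ext i a b
    by_contra hne'
    have h3 := hx.2.1 i a b hne'
    subst h3
    have h4 := hf.height_ne_zero (affRoot_ne_zero_iff.1 h0)
    rw [mem_heightPos_iff] at hα
    exact hne' (coord_eq_zero_of_mem_borelOf hn hm hf hxb i a b (by omega))
  · intro hα
    have h1 : α ∈ rootsOf (affAlg 𝕜 n m) := by
      rw [← hf.roots_inter_closure hn hm] at hα
      exact hα.1
    refine ⟨h1.1, ?_⟩
    obtain ⟨x, ⟨_, hx⟩, hne⟩ := Submodule.exists_mem_ne_zero_of_ne_bot h1.2
    refine (Submodule.ne_bot_iff _).2 ⟨x, ⟨?_, hx⟩, hne⟩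
    rw [hf.borelOf_eq hn hm]
    exact Submodule.mem_sup_right
      (Submodule.mem_iSup_of_mem α (Submodule.mem_iSup_of_mem hα hx))

/-- Heights add up: a positive root of height at least two splits at the successor of its first
symbol, while 1 is not a sum of two positive integers. -/
theorem IsPositioning.simpleRoots_borelOf (hn : 1 ≤ n) (hm : 1 ≤ m) {f : Idx n m → ℤ}
    (hf : IsPositioning f) : simpleRoots (borelOf (heightOne 𝕜 f)) = heightOne 𝕜 f := by
  ext α
  simp only [simpleRoots, hf.rootsOf_borelOf hn hm, Set.mem_ofPred_eq]
  constructor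
  · rintro ⟨⟨a, b, s, h, rfl⟩, hs⟩
    rw [mem_heightOne_iff]
    by_contra hne
    obtain ⟨c, t, hc⟩ := hf.exists_succ a
    have h1 := height_add f a c b t (s - t)
    rw [add_sub_cancel] at h1
    refine hs _ ⟨a, c, t, by omega, rfl⟩ _ ⟨c, b, s - t, by omega, rfl⟩ ?_
    rw [affRoot_rootVec_add, add_sub_cancel]
  · rintro ⟨a, b, s, h, rfl⟩
    refine ⟨⟨a, b, s, by omega, rfl⟩, ?_⟩
    rintro _ ⟨u, v, t, h1, rfl⟩ _ ⟨u', v', t', h2, rfl⟩ he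
    have := affRoot_add_separates he.symm f ((n : ℤ) + m)
    unfold height at h h1 h2
    omega

/-- A positioning is determined by its weights of height one, up to a constant. -/
theorem IsPositioning.sub_eq_of_heightOne_eq (hn : 1 ≤ n) {f g : Idx n m → ℤ}
    (hf : IsPositioning f) (h : heightOne 𝕜 f = heightOne 𝕜 g) (a b : Idx n m) :
    f b - f a = g b - g a := by
  -- Each step to the successor in the `f`-ordering is a weight of height one for `g` too, so walks
  -- of `k` steps have the same length in both.
  have key : ∀ (k : ℕ) (a b : Idx n m) (s : ℤ), height f a b s = k → height g a b s = k := by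
    intro k
    induction k with
    | zero =>
      intro a b s h0
      by_cases hc : a ≠ b ∨ s ≠ 0
      · exact absurd h0 (hf.height_ne_zero hc)
      · push Not at hc
        obtain ⟨rfl, rfl⟩ := hc
        simp [height]
    | succ k ih =>
      intro a b s hs
      obtain ⟨c, t, hc⟩ := hf.exists_succ a
      have h1 := height_add f a c b t (s - t)
      have h2 := height_add g a c b t (s - t)
      rw [add_sub_cancel] at h1 h2
      have h3 : height g a c t = 1 := by
        rw [← mem_heightOne_iff (𝕜 := 𝕜), ← h, mem_heightOne_iff]
        exact hc
      push_cast at hs ⊢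
      have := ih c b (s - t) (by omega)
      omega
  -- Only nonnegative heights are covered by `key`; adding `|f b - f a|` periods makes the height
  -- nonnegative, and the same term cancels on both sides afterwards.
  have hpos : 0 ≤ height f a b |f b - f a| := by
    unfold height
    have h1 : 0 ≤ ((n : ℤ) + m - 1) * |f b - f a| :=
      mul_nonneg (by omega) (abs_nonneg _)
    have h2 := neg_abs_le (f b - f a)
    linarith
  obtain ⟨k, hk⟩ := Int.eq_ofNat_of_zero_le hpos
  have := key k a b _ hk
  unfold height at this hk
  linarith

end Roots

/-! ### The positions attached to a shuffle and an integer -/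

section Positions

variable {n m : ℕ}

/-- The positions of the weights `ε_a` in the ordering attached to the shuffle `w` and `k`. -/
def position (w : Fin (n + m) ≃ Idx n m) (k : ℤ) (a : Idx n m) : ℤ :=
  (w.symm ((nu n m ^ k) a) : ℕ) + ((n : ℤ) + m) * shift k ((nu n m ^ k) a)

theorem nu_zpow_globalIdx (k : ℤ) (a : Idx n m) : (nu n m ^ k) (globalIdx k a) = a := by
  rw [globalIdx, ← Equiv.Perm.mul_apply, ← zpow_add]
  simp

theorem globalIdx_nu_zpow (k : ℤ) (a : Idx n m) : globalIdx k ((nu n m ^ k) a) = a := by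
  rw [globalIdx, ← Equiv.Perm.mul_apply, ← zpow_add]
  simp

theorem globalIdx_injective (k : ℤ) : Function.Injective (globalIdx k : Idx n m → Idx n m) :=
  (nu n m ^ (-k)).injective

theorem position_globalIdx (w : Fin (n + m) ≃ Idx n m) (k : ℤ) (a : Idx n m) :
    position w k (globalIdx k a) = (w.symm a : ℕ) + ((n : ℤ) + m) * shift k a := by
  rw [position, nu_zpow_globalIdx]

theorem eq_of_eq_add_mul {N : ℕ} {p q : Fin N} {t : ℤ} (h : ((p : ℕ) : ℤ) = (q : ℕ) + N * t) :
    p = q := by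
  have h1 := congrArg (fun z : ℤ => z % N) h
  simp only [Int.add_mul_emod_self_left] at h1
  rw [Int.emod_eq_of_lt (by omega) (by omega), Int.emod_eq_of_lt (by omega) (by omega)] at h1
  exact Fin.ext (by exact_mod_cast h1)

theorem isPositioning_position (hn : 1 ≤ n) (w : Fin (n + m) ≃ Idx n m) (k : ℤ) :
    IsPositioning (position w k) where
  surj z := by
    have hN : (0 : ℤ) < (n : ℤ) + m := by omega
    have h1 := Int.emod_nonneg z hN.ne'
    have h2 := Int.emod_lt_of_pos z hN
    have h3 := Int.emod_add_mul_ediv z ((n : ℤ) + m)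
    refine ⟨globalIdx k (w ⟨(z % ((n : ℤ) + m)).toNat, by omega⟩),
      z / ((n : ℤ) + m) - shift k (w ⟨(z % ((n : ℤ) + m)).toNat, by omega⟩), ?_⟩
    rw [position_globalIdx, Equiv.symm_apply_apply]
    simp only [Int.toNat_of_nonneg h1]
    linarith
  inj a b t h := by
    have h1 : w.symm ((nu n m ^ k) a) = w.symm ((nu n m ^ k) b) := by
      unfold position at h
      refine eq_of_eq_add_mul (t := t + shift k ((nu n m ^ k) b) - shift k ((nu n m ^ k) a)) ?_
      push_cast
      linarith
    exact (nu n m ^ k).injective (w.symm.injective h1)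

/-- The shifts cancel: in local terms the symbol of `a` sits at its place in the word `w`, and
`deltaBar` contributes one period. -/
theorem height_position (w : Fin (n + m) ≃ Idx n m) (k : ℤ) (a b : Idx n m) (t : ℤ) :
    height (position w k) (globalIdx k a) (globalIdx k b) (shift k a - shift k b + t) =
      (w.symm b : ℕ) - (w.symm a : ℕ) + ((n : ℤ) + m) * t := by
  rw [height, position_globalIdx, position_globalIdx]
  ring

end Positions

/-! ### Extensions of the embedded finite Borel subalgebras -/

section Local

variable {𝕜 : Type*} [Field 𝕜] {n m : ℕ}

variable (𝕜) in
/-- The image of the weight `ε_a` under the `k`-th embedding. -/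
noncomputable def localEps (k : ℤ) (a : Idx n m) : Wt 𝕜 n m :=
  eps 𝕜 (globalIdx k a) + shift k a • deltaBar 𝕜 n m

theorem localEps_sub (k : ℤ) (a b : Idx n m) : localEps 𝕜 k a - localEps 𝕜 k b =
    affRoot 𝕜 (rootVec (globalIdx k a) (globalIdx k b)) (shift k a - shift k b) := by
  rw [affRoot_rootVec, localEps, localEps, sub_smul]
  abel

theorem embed_coord (k : ℤ) (x : Mat 𝕜 n m) (i : ℤ) (c d : Idx n m) :
    (embed 𝕜 n m k x).1 i (globalIdx k c) (globalIdx k d) =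
      if i = shift k c - shift k d then x c d else 0 := by
  change (∑ a, ∑ b, Finsupp.single (shift k a - shift k b)
        (Matrix.single (globalIdx k a) (globalIdx k b) (x a b))) i
          (globalIdx k c) (globalIdx k d) = _
  simp only [Finsupp.finsetSum_apply, Matrix.sum_apply]
  rw [Finset.sum_eq_single c, Finset.sum_eq_single d]
  · by_cases h : i = shift k c - shift k d
    · simp [h]
    · simp [h]
  · intro b _ hb
    by_cases h : i = shift k c - shift k b
    · subst h
      simp [(globalIdx_injective k).eq_iff, hb]
    · simp [h]
  · simp
  · intro a _ ha
    refine Finset.sum_eq_zero fun b _ => ?_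
    by_cases h : i = shift k a - shift k b
    · subst h
      simp [(globalIdx_injective k).eq_iff, ha]
    · simp [h]
  · simp

theorem embed_single (k : ℤ) {a b : Idx n m} (hab : a ≠ b) :
    embed 𝕜 n m k (Matrix.single a b 1) = (Finsupp.single (shift k a - shift k b)
      (Matrix.single (globalIdx k a) (globalIdx k b) 1), 0, 0) := by
  refine Prod.ext ?_ (Prod.ext ?_ rfl)
  · ext i u v
    rw [← globalIdx_nu_zpow k u, ← globalIdx_nu_zpow k v, embed_coord]
    generalize (nu n m ^ k) u = c
    generalize (nu n m ^ k) v = d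
    by_cases h : a = c ∧ b = d
    · obtain ⟨rfl, rfl⟩ := h
      by_cases hi : i = shift k a - shift k b
      · simp [hi]
      · simp [hi]
    · rw [Matrix.single_apply_of_ne _ _ _ _ _ h, ite_self]
      by_cases hi : i = shift k a - shift k b
      · subst hi
        rw [Finsupp.single_eq_same, Matrix.single_apply_of_ne]
        simpa [(globalIdx_injective k).eq_iff] using h
      · simp [hi]
  · change ∑ c, (sgn c : 𝕜) * (shift k c : 𝕜) * (Matrix.single a b (1 : 𝕜)) c c = 0
    refine Finset.sum_eq_zero fun c _ => ?_
    rw [Matrix.single_apply_of_ne, mul_zero]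
    rintro ⟨rfl, rfl⟩
    exact hab rfl

theorem single_mem_finBorel {w : Fin (n + m) ≃ Idx n m} {a b : Idx n m}
    (h : w.symm a < w.symm b) : Matrix.single a b (1 : 𝕜) ∈ finBorel 𝕜 w := by
  refine ⟨fun _ => Finset.sum_eq_zero fun c _ => ?_, fun c d hcd => ?_⟩
  · rw [Matrix.single_apply_of_ne, mul_zero]
    rintro ⟨rfl, rfl⟩
    exact lt_irrefl _ h
  · rw [Matrix.single_apply_of_ne]
    rintro ⟨rfl, rfl⟩
    exact lt_asymm h hcd

variable [CharZero 𝕜]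

theorem rootsOf_map_embed (w : Fin (n + m) ≃ Idx n m) (k : ℤ) :
    rootsOf ((finBorel 𝕜 w).map (embed 𝕜 n m k)) =
      {α | ∃ a b, w.symm a < w.symm b ∧ α = localEps 𝕜 k a - localEps 𝕜 k b} := by
  ext α
  constructor
  · rintro ⟨h0, h⟩
    obtain ⟨_, ⟨⟨x, hx, rfl⟩, hy⟩, hne⟩ := Submodule.exists_mem_ne_zero_of_ne_bot h
    replace hy := (mem_rootSpace_iff _ _).1 hy
    obtain ⟨c, d, hcd⟩ : ∃ c d, x c d ≠ 0 := by
      by_contra! hc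
      refine hne ?_
      rw [show x = 0 from Matrix.ext hc, map_zero]
    have h1 := hy.2.1 (shift k c - shift k d) (globalIdx k c) (globalIdx k d) (by
      rwa [embed_coord, if_pos rfl])
    rw [← localEps_sub] at h1
    refine ⟨c, d, lt_of_le_of_ne (not_lt.1 fun hlt => hcd (hx.2 c d hlt)) fun he => ?_, h1.symm⟩
    rw [w.symm.injective he, sub_self] at h1
    exact h0 h1.symm
  · rintro ⟨a, b, h, rfl⟩
    have hab : a ≠ b := by
      rintro rfl
      exact lt_irrefl _ h
    rw [localEps_sub]
    refine ⟨affRoot_ne_zero_iff.2 (Or.inl fun hc => hab (globalIdx_injective k hc)),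
      (Submodule.ne_bot_iff _).2 ⟨embed 𝕜 n m k (Matrix.single a b 1),
        ⟨⟨_, single_mem_finBorel h, rfl⟩, ?_⟩, fun hc => ?_⟩⟩
    · rw [embed_single k hab]
      exact single_mem_rootSpace (fun hc => hab (globalIdx_injective k hc)) _ _
    · have := congrArg (fun y : Amb 𝕜 n m =>
        y.1 (shift k a - shift k b) (globalIdx k a) (globalIdx k b)) hc
      simp only [embed_coord] at this
      simp at this

theorem simpleRoots_map_embed (w : Fin (n + m) ≃ Idx n m) (k : ℤ) :
    simpleRoots ((finBorel 𝕜 w).map (embed 𝕜 n m k)) =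
      {α | ∃ p q : Fin (n + m), (p : ℕ) + 1 = q ∧
        α = localEps 𝕜 k (w p) - localEps 𝕜 k (w q)} := by
  ext α
  simp only [simpleRoots, rootsOf_map_embed, Set.mem_ofPred_eq]
  constructor
  · rintro ⟨⟨a, b, h, rfl⟩, hs⟩
    refine ⟨w.symm a, w.symm b, ?_, by simp⟩
    by_contra hne
    have hlt : (w.symm a : ℕ) + 1 < w.symm b := by
      have : (w.symm a : ℕ) < w.symm b := h
      omega
    refine hs _ ⟨a, w ⟨(w.symm a : ℕ) + 1, by omega⟩, ?_, rfl⟩ _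
      ⟨w ⟨(w.symm a : ℕ) + 1, by omega⟩, b, ?_, rfl⟩ (sub_add_sub_cancel _ _ _).symm
    · rw [Equiv.symm_apply_apply, Fin.lt_def]
      simp
    · rw [Equiv.symm_apply_apply, Fin.lt_def]
      exact hlt
  · rintro ⟨p, q, hpq, rfl⟩
    refine ⟨⟨w p, w q, ?_, rfl⟩, ?_⟩
    · simp only [Equiv.symm_apply_apply, Fin.lt_def]
      omega
    · rintro _ ⟨a, b, hab, rfl⟩ _ ⟨c, d, hcd, rfl⟩ he
      simp only [localEps_sub] at he
      -- Evaluated at the positions, a root of the local Borel subalgebra gives the distance of two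
      -- places in `w`; neighbours have distance 1, which is not a sum of two positive distances.
      have h1 := affRoot_add_separates he.symm (position w k) ((n : ℤ) + m)
      have h2 := height_position w k a b 0
      have h3 := height_position w k c d 0
      have h4 := height_position w k (w p) (w q) 0
      simp only [add_zero, mul_zero, height, Equiv.symm_apply_apply] at h2 h3 h4
      rw [h2, h3, h4] at h1
      rw [Fin.lt_def] at hab hcd
      omega

theorem localEps_sub_injective (w : Fin (n + m) ≃ Idx n m) (k : ℤ) {p q p' q' : Fin (n + m)}
    (hpq : p ≠ q) (h : localEps 𝕜 k (w p) - localEps 𝕜 k (w q) =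
      localEps 𝕜 k (w p') - localEps 𝕜 k (w q')) : p = p' := by
  rw [localEps_sub, localEps_sub] at h
  exact w.injective (globalIdx_injective k (affRoot_pair_injective
    (fun hc => hpq (w.injective (globalIdx_injective k hc))) h).1)

/-- The highest root is the difference of the first and the last weight. -/
theorem finsum_simpleRoots (w : Fin (n + m) ≃ Idx n m) (k : ℤ) {p q : Fin (n + m)}
    (hp : (p : ℕ) = 0) (hq : (q : ℕ) + 1 = n + m) :
    ∑ᶠ α ∈ simpleRoots ((finBorel 𝕜 w).map (embed 𝕜 n m k)), α =
      localEps 𝕜 k (w p) - localEps 𝕜 k (w q) := by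
  -- Indexing by `ℕ` makes the sum telescope. Only indices up to `q = n + m - 1` occur, so the
  -- default value 0 plays no role.
  let E : ℕ → Wt 𝕜 n m := fun r => if h : r < n + m then localEps 𝕜 k (w ⟨r, h⟩) else 0
  have hE : ∀ r : Fin (n + m), E r = localEps 𝕜 k (w r) := fun r => by simp [E]
  have hset : simpleRoots ((finBorel 𝕜 w).map (embed 𝕜 n m k)) =
      (fun r => E r - E (r + 1)) '' (Finset.range q : Set ℕ) := by
    rw [simpleRoots_map_embed]
    ext α
    constructor
    · rintro ⟨r, s, hrs, rfl⟩
      refine ⟨r, by simp; omega, ?_⟩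
      simp only [hrs, hE]
    · rintro ⟨r, hr, rfl⟩
      have hr' : r < q := by simpa using hr
      refine ⟨⟨r, by omega⟩, ⟨r + 1, by omega⟩, rfl, ?_⟩
      simp only [← hE]
  rw [hset, finsum_mem_image, finsum_mem_coe_finset, Finset.sum_range_sub', ← hp, hE, hE]
  -- A sum over a set counts equal terms once, so the simple roots must be seen to be distinct.
  intro r hr s hs h
  have hr' : r < q := by simpa using hr
  have hs' : s < q := by simpa using hs
  have := localEps_sub_injective (𝕜 := 𝕜) w k (p := ⟨r, by omega⟩) (q := ⟨r + 1, by omega⟩)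
    (p' := ⟨s, by omega⟩) (q' := ⟨s + 1, by omega⟩) (by simp) (by simpa only [← hE] using h)
  simpa using this

/-- Every step of the periodic ordering is a translate of one starting in the window. Steps staying
inside are the local simple roots; the one leaving it is the extending root. -/
theorem extension_map_embed (hn : 1 ≤ n) (w : Fin (n + m) ≃ Idx n m) (k : ℤ) :
    extension ((finBorel 𝕜 w).map (embed 𝕜 n m k)) = borelOf (heightOne 𝕜 (position w k)) := by
  rw [extension, finsum_simpleRoots w k (p := ⟨0, by omega⟩) (q := ⟨n + m - 1, by omega⟩) rfl
    (by simp; omega), simpleRoots_map_embed]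
  congr 1
  have hθ : ∀ p q : Fin (n + m), deltaBar 𝕜 n m - (localEps 𝕜 k (w p) - localEps 𝕜 k (w q)) =
      affRoot 𝕜 (rootVec (globalIdx k (w q)) (globalIdx k (w p)))
        (shift k (w q) - shift k (w p) + 1) := by
    intro p q
    rw [affRoot_rootVec, localEps, localEps, add_smul, sub_smul, one_smul]
    abel
  rw [hθ]
  ext α
  constructor
  · rintro (rfl | ⟨p, q, hpq, rfl⟩)
    · rw [mem_heightOne_iff, height_position]
      simp only [Equiv.symm_apply_apply]
      omega
    · rw [localEps_sub, mem_heightOne_iff, ← add_zero (shift k (w p) - _), height_position]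
      simp only [Equiv.symm_apply_apply]
      omega
  · rintro ⟨a, b, s, h, rfl⟩
    obtain ⟨a, rfl⟩ := (nu n m ^ (-k)).surjective a
    obtain ⟨b, rfl⟩ := (nu n m ^ (-k)).surjective b
    change height _ (globalIdx k a) (globalIdx k b) s = 1 at h
    change affRoot 𝕜 (rootVec (globalIdx k a) (globalIdx k b)) s ∈ _
    obtain ⟨t, rfl⟩ : ∃ t, s = shift k a - shift k b + t := ⟨s - (shift k a - shift k b), by ring⟩
    obtain ⟨p, rfl⟩ := w.surjective a
    obtain ⟨q, rfl⟩ := w.surjective b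
    rw [height_position, Equiv.symm_apply_apply, Equiv.symm_apply_apply] at h
    have hN : (0 : ℤ) < (n : ℤ) + m := by omega
    -- Two places of the window differ by less than one period, so a neighbour is found in the
    -- window itself or in the next translate.
    have ht : t = 0 ∨ t = 1 := by
      have h1 : t < 2 := by
        by_contra! hc
        have := mul_le_mul_of_nonneg_left hc hN.le
        omega
      have h2 : -1 < t := by
        by_contra! hc
        have := mul_le_mul_of_nonneg_left hc hN.le
        omega
      omega
    rcases ht with rfl | rfl
    · right
      refine ⟨p, q, by omega, ?_⟩
      rw [add_zero, localEps_sub]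
    · left
      have hp : p = ⟨n + m - 1, by omega⟩ := Fin.ext (by simp; omega)
      have hq : q = ⟨0, by omega⟩ := Fin.ext (by simp; omega)
      rw [← hp, ← hq]

theorem extendFrom_shuffleBorel (hn : 1 ≤ n) (w : Fin (n + m) ≃ Idx n m) (hw : IsShuffle w)
    (k : ℤ) : (extendFrom 𝕜 (shuffleBorel 𝕜 w hw) k : Submodule 𝕜 (Amb 𝕜 n m)) =
      borelOf (heightOne 𝕜 (position w k)) :=
  extension_map_embed hn w k

end Local

/-! ### Rotations of windows and the bijection with equivalence classes -/

section Rotation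

variable {n m : ℕ}

theorem finRotate_val_of_lt {N : ℕ} {i : Fin N} (h : (i : ℕ) + 1 < N) :
    (finRotate N i : ℕ) = i + 1 := by
  obtain ⟨N, rfl⟩ : ∃ M, N = M + 1 := ⟨N - 1, by omega⟩
  rw [coe_finRotate, if_neg]
  rintro rfl
  simp at h

theorem finRotate_val_of_eq {N : ℕ} {i : Fin N} (h : (i : ℕ) + 1 = N) :
    (finRotate N i : ℕ) = 0 := by
  obtain ⟨N, rfl⟩ : ∃ M, N = M + 1 := ⟨N - 1, by omega⟩
  rw [coe_finRotate, if_pos]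
  exact Fin.ext (by simpa using h)

theorem nu_inl (i : Fin n) : nu n m (Sum.inl i) = Sum.inl (finRotate n i) := rfl

theorem nu_inr (j : Fin m) : nu n m (Sum.inr j) = Sum.inr j := rfl

theorem nu_zpow_inr (k : ℤ) (j : Fin m) : (nu n m ^ k) (Sum.inr j) = Sum.inr j :=
  Equiv.Perm.zpow_apply_eq_self_of_apply_eq_self (nu_inr j) k

theorem finRotate_val_emod (i : Fin n) : ((finRotate n i : ℕ) : ℤ) = ((i : ℕ) + 1 : ℤ) % n := by
  rcases Nat.lt_or_ge ((i : ℕ) + 1) n with h | h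
  · rw [finRotate_val_of_lt h, Int.emod_eq_of_lt (by omega) (by omega)]
    simp
  · have h1 : (i : ℕ) + 1 = n := by omega
    rw [finRotate_val_of_eq h1]
    have h2 : ((i : ℕ) + 1 : ℤ) = n := by omega
    rw [h2]
    simp

theorem nu_zpow_inl (k : ℤ) : ∀ i : Fin n, ∃ i' : Fin n,
    (nu n m ^ k) (Sum.inl i) = Sum.inl i' ∧ ((i' : ℕ) : ℤ) = ((i : ℕ) + k : ℤ) % n := by
  induction k using Int.induction_on with
  | zero =>
    intro i
    refine ⟨i, rfl, ?_⟩
    rw [add_zero, Int.emod_eq_of_lt (by omega) (by omega)]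
  | succ k ih =>
    intro i
    obtain ⟨i', h1, h2⟩ := ih i
    refine ⟨finRotate n i', ?_, ?_⟩
    · rw [add_comm, zpow_add, Equiv.Perm.mul_apply, h1, zpow_one, nu_inl]
    · rw [finRotate_val_emod, h2, Int.emod_add_emod, add_assoc]
  | pred k ih =>
    intro i
    obtain ⟨i', h1, h2⟩ := ih i
    refine ⟨(finRotate n).symm i', ?_, ?_⟩
    · rw [sub_eq_add_neg, add_comm, zpow_add, Equiv.Perm.mul_apply, h1, zpow_neg_one,
        Equiv.Perm.inv_eq_iff_eq, nu_inl, Equiv.apply_symm_apply]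
    · have h3 := finRotate_val_emod ((finRotate n).symm i')
      rw [Equiv.apply_symm_apply, h2] at h3
      have h4 : ((i : ℕ) + (-(k : ℤ) - 1)) % n = (((finRotate n).symm i' : ℕ) : ℤ) % n := by
        have h5 : ((i : ℕ) + -(k : ℤ)) ≡ (((finRotate n).symm i' : ℕ) : ℤ) + 1 [ZMOD n] := h3
        have h6 := h5.sub_right 1
        rw [add_sub_cancel_right, add_sub_assoc] at h6
        exact h6
      rw [h4, Int.emod_eq_of_lt (by omega) (by omega)]

theorem shift_inl (k : ℤ) (i : Fin n) :
    shift k (Sum.inl i : Idx n m) = -((((i : ℕ) : ℤ) - k) / n) := by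
  rw [← Int.fdiv_eq_ediv_of_nonneg _ (by omega)]
  rfl

theorem shift_inr (k : ℤ) (j : Fin m) : shift k (Sum.inr j : Idx n m) = 0 := rfl

theorem position_inr (w : Fin (n + m) ≃ Idx n m) (k : ℤ) (j : Fin m) :
    position w k (Sum.inr j) = (w.symm (Sum.inr j) : ℕ) := by
  rw [position, nu_zpow_inr, shift_inr, mul_zero, add_zero]

/-- Division of `i + k` by `n`: the remainder is the local index, the quotient is the number of
periods by which the symbol is displaced. -/
theorem position_inl (w : Fin (n + m) ≃ Idx n m) (k : ℤ) (i : Fin n) : ∃ i' : Fin n,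
    ((i' : ℕ) : ℤ) = ((i : ℕ) + k : ℤ) % n ∧ position w k (Sum.inl i) =
      (w.symm (Sum.inl i') : ℕ) + ((n : ℤ) + m) * (((i : ℕ) + k : ℤ) / n) := by
  obtain ⟨i', h1, h2⟩ := nu_zpow_inl (m := m) k i
  refine ⟨i', h2, ?_⟩
  have h3 := Int.emod_add_mul_ediv ((i : ℕ) + k : ℤ) n
  have h4 : ((i' : ℕ) : ℤ) - k = (i : ℕ) + n * (-(((i : ℕ) + k : ℤ) / n)) := by
    rw [h2]
    linarith
  have hn := i.pos
  rw [position, h1, shift_inl, h4, Int.add_mul_ediv_left _ _ (by omega),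
    Int.ediv_eq_zero_of_lt (by omega) (by omega), zero_add, neg_neg]

theorem rotate_symm_nu (w : Fin (n + m) ≃ Idx n m) (a : Idx n m) :
    (rotate w).symm (nu n m a) = finRotate (n + m) (w.symm a) := by
  rw [Equiv.symm_apply_eq]
  simp only [rotate, Equiv.trans_apply, Equiv.symm_apply_apply, Equiv.apply_symm_apply]

theorem EndsInN.symm_val {w : Fin (n + m) ≃ Idx n m} (h : EndsInN w) {i : Fin n}
    (hi : (i : ℕ) + 1 = n) : (w.symm (Sum.inl i) : ℕ) + 1 = n + m := by
  obtain ⟨p, i', hp, hi', hw⟩ := h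
  have : i = i' := Fin.ext (by omega)
  rw [this, ← hw, Equiv.symm_apply_apply]
  exact hp

theorem EndsInN.symm_val_lt {w : Fin (n + m) ≃ Idx n m} (h : EndsInN w) {a : Idx n m}
    (ha : ∀ i : Fin n, a = Sum.inl i → (i : ℕ) + 1 ≠ n) : (w.symm a : ℕ) + 1 < n + m := by
  obtain ⟨p, i, hp, hi, hw⟩ := h
  by_contra hc
  have h1 : w.symm a = p := Fin.ext (by omega)
  exact ha i (by rw [← hw, ← h1, Equiv.apply_symm_apply]) hi

theorem EndsInN.rotate_symm_inr {w : Fin (n + m) ≃ Idx n m} (h : EndsInN w) (j : Fin m) :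
    ((rotate w).symm (Sum.inr j) : ℕ) = w.symm (Sum.inr j) + 1 := by
  rw [← nu_inr, rotate_symm_nu, finRotate_val_of_lt (h.symm_val_lt (by simp)), nu_inr]

theorem EndsInN.rotate_symm_inl_zero {w : Fin (n + m) ≃ Idx n m} (h : EndsInN w) {i : Fin n}
    (hi : (i : ℕ) = 0) : ((rotate w).symm (Sum.inl i) : ℕ) = 0 := by
  have hn := i.pos
  have h1 : Sum.inl i = nu n m (Sum.inl ⟨n - 1, by omega⟩) := by
    rw [nu_inl]
    congr 1
    refine Fin.ext ?_
    rw [finRotate_val_of_eq (by simp; omega), hi]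
  rw [h1, rotate_symm_nu, finRotate_val_of_eq]
  exact h.symm_val (by simp; omega)

theorem EndsInN.rotate_symm_inl_succ {w : Fin (n + m) ≃ Idx n m} (h : EndsInN w) {i i' : Fin n}
    (hi : (i' : ℕ) = i + 1) :
    ((rotate w).symm (Sum.inl i') : ℕ) = w.symm (Sum.inl i) + 1 := by
  have h1 : Sum.inl i' = nu n m (Sum.inl i) := by
    rw [nu_inl]
    congr 1
    refine Fin.ext ?_
    rw [finRotate_val_of_lt (by omega), hi]
  rw [h1, rotate_symm_nu, finRotate_val_of_lt]
  refine h.symm_val_lt fun i'' h2 => ?_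
  have := Sum.inl.inj h2
  subst this
  omega

theorem isShuffle_rotate {w : Fin (n + m) ≃ Idx n m} (hw : IsShuffle w) (h : EndsInN w) :
    IsShuffle (rotate w) := by
  refine ⟨fun i j hij => ?_, fun i j hij => ?_⟩
  · rw [Fin.lt_def] at hij ⊢
    obtain ⟨j', hj'⟩ : ∃ j' : Fin n, (j : ℕ) = j' + 1 :=
      ⟨⟨j - 1, by omega⟩, by simp; omega⟩
    rw [h.rotate_symm_inl_succ hj']
    rcases Nat.eq_zero_or_pos (i : ℕ) with h0 | h0
    · rw [h.rotate_symm_inl_zero h0]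
      omega
    · obtain ⟨i', hi'⟩ : ∃ i' : Fin n, (i : ℕ) = i' + 1 :=
        ⟨⟨i - 1, by omega⟩, by simp; omega⟩
      rw [h.rotate_symm_inl_succ hi']
      have := hw.1 i' j' (by rw [Fin.lt_def]; omega)
      rw [Fin.lt_def] at this
      omega
  · have := hw.2 i j hij
    rw [Fin.lt_def] at this ⊢
    rw [h.rotate_symm_inr, h.rotate_symm_inr]
    omega

theorem exists_rotate_eq {w : Fin (n + m) ≃ Idx n m} (hw : IsShuffle w) {p : Fin (n + m)}
    {i : Fin n} (hp : (p : ℕ) = 0) (hpi : w p = Sum.inl i) :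
    ∃ w', IsShuffle w' ∧ EndsInN w' ∧ rotate w' = w := by
  have hn := i.pos
  have hi : (i : ℕ) = 0 := by
    by_contra hc
    have := hw.1 ⟨0, hn⟩ i (by rw [Fin.lt_def]; simp; omega)
    rw [← hpi, Equiv.symm_apply_apply, Fin.lt_def] at this
    omega
  let w' : Fin (n + m) ≃ Idx n m := ((finRotate (n + m)).trans w).trans (nu n m).symm
  have hrot : rotate w' = w := by
    refine Equiv.ext fun q => ?_
    simp only [rotate, w', Equiv.trans_apply, Equiv.apply_symm_apply]
  have hend : EndsInN w' := by
    refine ⟨⟨n + m - 1, by omega⟩, ⟨n - 1, by omega⟩, by simp; omega, by simp; omega, ?_⟩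
    simp only [w', Equiv.trans_apply]
    rw [Equiv.symm_apply_eq, nu_inl]
    have h1 : finRotate (n + m) ⟨n + m - 1, by omega⟩ = p :=
      Fin.ext (by rw [finRotate_val_of_eq (by simp; omega), hp])
    have h2 : finRotate n ⟨n - 1, by omega⟩ = i :=
      Fin.ext (by rw [finRotate_val_of_eq (by simp; omega), hi])
    rw [h1, h2, hpi]
  refine ⟨w', ⟨fun a b hab => ?_, fun a b hab => ?_⟩, hend, hrot⟩
  · rw [Fin.lt_def] at hab ⊢
    by_cases hb : (b : ℕ) + 1 = n
    · have h1 := hend.symm_val hb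
      have h2 := hend.symm_val_lt (a := Sum.inl a) (by rintro _ ⟨⟩; omega)
      omega
    · have h1 := hend.rotate_symm_inl_succ (i := a) (i' := ⟨a + 1, by omega⟩) rfl
      have h2 := hend.rotate_symm_inl_succ (i := b) (i' := ⟨b + 1, by omega⟩) rfl
      have h3 := hw.1 ⟨a + 1, by omega⟩ ⟨b + 1, by omega⟩ (by rw [Fin.lt_def]; simp; omega)
      rw [hrot] at h1 h2
      rw [Fin.lt_def] at h3
      omega
  · have h1 := hend.rotate_symm_inr a
    have h2 := hend.rotate_symm_inr b
    have h3 := hw.2 a b hab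
    rw [hrot] at h1 h2
    rw [Fin.lt_def] at h3 ⊢
    omega

/-- All letters but the last move one place to the right with unchanged shift. The last one falls
from place `n + m - 1` to place 0, but its shift grows by one, which again amounts to one step to
the right. -/
theorem position_rotate {w : Fin (n + m) ≃ Idx n m} (h : EndsInN w) (k : ℤ) (a : Idx n m) :
    position (rotate w) (k + 1) a = position w k a + 1 := by
  unfold position
  rw [add_comm k 1, zpow_add, Equiv.Perm.mul_apply, zpow_one]
  generalize (nu n m ^ k) a = x
  rcases x with i | j
  · rcases Nat.lt_or_ge ((i : ℕ) + 1) n with hi | hi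
    · have h1 := finRotate_val_of_lt hi
      rw [nu_inl, h.rotate_symm_inl_succ h1, shift_inl, shift_inl, h1]
      push_cast
      rw [add_comm (i : ℤ) 1, add_sub_add_left_eq_sub]
      ring
    · have hi' : (i : ℕ) + 1 = n := by omega
      have h1 := finRotate_val_of_eq hi'
      have h2 := h.symm_val hi'
      rw [nu_inl, h.rotate_symm_inl_zero h1, shift_inl, shift_inl, h1]
      have h3 : ((i : ℕ) : ℤ) - k = ((0 : ℕ) : ℤ) - (1 + k) + n * 1 := by omega
      rw [h3, Int.add_mul_ediv_left _ _ (by omega)]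
      have h4 : ((w.symm (Sum.inl i) : ℕ) : ℤ) + 1 = n + m := by exact_mod_cast h2
      push_cast
      linear_combination -h4
  · rw [nu_inr, h.rotate_symm_inr, shift_inr, shift_inr]
    push_cast
    ring

/-- The unprimed letters fill the remaining places, and in increasing order there is only one way to
do so. -/
theorem shuffle_ext {w w' : Fin (n + m) ≃ Idx n m} (hw : IsShuffle w) (hw' : IsShuffle w')
    (h : ∀ j : Fin m, w.symm (Sum.inr j) = w'.symm (Sum.inr j)) : w = w' := by
  have hr : ∀ v : Fin (n + m) ≃ Idx n m, Set.range (fun i : Fin n => v.symm (Sum.inl i)) =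
      (Set.range fun j : Fin m => v.symm (Sum.inr j))ᶜ := by
    intro v
    ext p
    simp only [Set.mem_range, Set.mem_compl_iff, Equiv.symm_apply_eq]
    cases hp : v p <;> simp
  have h1 : (fun i : Fin n => w.symm (Sum.inl i)) = fun i => w'.symm (Sum.inl i) := by
    refine (StrictMono.range_inj (fun i j => hw.1 i j) (fun i j => hw'.1 i j)).1 ?_
    rw [hr, hr]
    simp only [h]
  have h2 : w.symm = w'.symm := by
    ext a
    rcases a with i | j
    · exact congrArg Fin.val (congrFun h1 i)
    · exact congrArg Fin.val (h j)
  exact Equiv.symm_bijective.1 h2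

/-- The positions of the primed letters are their places in the word, so they determine the shuffle.
The position of the first unprimed symbol then yields the remainder and the quotient of `k` by `n`.
-/
theorem eq_of_position_eq (hn : 1 ≤ n) {w w' : Fin (n + m) ≃ Idx n m} (hw : IsShuffle w)
    (hw' : IsShuffle w') {k k' : ℤ} (h : ∀ a, position w' k' a = position w k a) :
    w = w' ∧ k = k' := by
  have h1 : w = w' := by
    refine shuffle_ext hw hw' fun j => ?_
    have := h (Sum.inr j)
    rw [position_inr, position_inr] at this
    exact Fin.ext (by exact_mod_cast this.symm)
  subst h1
  refine ⟨rfl, ?_⟩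
  obtain ⟨i, hi, hp⟩ := position_inl w k ⟨0, hn⟩
  obtain ⟨i', hi', hp'⟩ := position_inl w k' ⟨0, hn⟩
  have h2 := h (Sum.inl ⟨0, hn⟩)
  rw [hp, hp'] at h2
  simp only [Nat.cast_zero, zero_add] at h2 hi hi'
  have h3 : w.symm (Sum.inl i) = w.symm (Sum.inl i') := by
    refine eq_of_eq_add_mul (t := k' / n - k / n) ?_
    push_cast
    linarith
  have h4 : i = i' := Sum.inl.inj (w.symm.injective h3)
  subst h4
  have h5 : ((n : ℤ) + m) * (k' / n) = ((n : ℤ) + m) * (k / n) := by linarith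
  have h6 := mul_left_cancel₀ (by omega) h5
  rw [← Int.emod_add_mul_ediv k n, ← Int.emod_add_mul_ediv k' n, ← hi, ← hi', h6]

/-- A primed letter at the last place would be pushed beyond `n + m - 1`, where no primed letter can
be. So the last letter is unprimed, and in a shuffle it is the largest one. -/
theorem endsInN_of_position (hn : 1 ≤ n) {w w' : Fin (n + m) ≃ Idx n m} (hw : IsShuffle w)
    {k k' c : ℤ} (hc : 0 < c) (h : ∀ a, position w' k' a = position w k a + c) : EndsInN w := by
  rcases hp : w ⟨n + m - 1, by omega⟩ with i | j
  · refine ⟨_, i, by simp; omega, ?_, hp⟩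
    by_contra hne
    have h1 := hw.1 i ⟨i + 1, by omega⟩ (by rw [Fin.lt_def]; simp)
    rw [← hp, Equiv.symm_apply_apply, Fin.lt_def] at h1
    simp only at h1
    omega
  · exfalso
    have h1 := h (Sum.inr j)
    rw [position_inr, position_inr, ← hp, Equiv.symm_apply_apply] at h1
    simp only at h1
    omega

variable (𝕜 : Type*) [Field 𝕜]

theorem borelClass_rotate {w : Fin (n + m) ≃ Idx n m} (hw : IsShuffle w) (h : EndsInN w) (k : ℤ) :
    borelClass 𝕜 (shuffleBorel 𝕜 w hw) k =
      borelClass 𝕜 (shuffleBorel 𝕜 (rotate w) (isShuffle_rotate hw h)) (k + 1) :=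
  Quotient.sound (Relation.EqvGen.rel _ _ ⟨w, hw, h, rfl, rfl, rfl⟩)

/-- As long as the offset is positive a rotation is possible, and it lowers the offset by one. -/
theorem borelClass_eq_of_position_add (hn : 1 ≤ n) {w' : Fin (n + m) ≃ Idx n m}
    (hw' : IsShuffle w') {k' : ℤ} (c : ℕ) : ∀ {w : Fin (n + m) ≃ Idx n m} (hw : IsShuffle w)
      {k : ℤ}, (∀ a, position w' k' a = position w k a + c) →
      borelClass 𝕜 (shuffleBorel 𝕜 w hw) k = borelClass 𝕜 (shuffleBorel 𝕜 w' hw') k' := by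
  induction c with
  | zero =>
    intro w hw k h
    obtain ⟨rfl, rfl⟩ := eq_of_position_eq hn hw hw' (fun a => by simpa using h a)
    rfl
  | succ c ih =>
    intro w hw k h
    have hend := endsInN_of_position hn hw (by positivity) h
    rw [borelClass_rotate 𝕜 hw hend]
    refine ih _ fun a => ?_
    rw [h, position_rotate hend]
    push_cast
    ring

theorem heightOne_add_const (f : Idx n m → ℤ) (c : ℤ) :
    heightOne 𝕜 (fun a => f a + c) = heightOne 𝕜 f := by
  simp [heightOne, height]

variable [CharZero 𝕜]

/-- Injectivity of the extension map on classes: the simple roots recover the positions up to a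
constant, and the window that is behind is rotated until it catches up. -/
theorem extendFrom_eq_iff (hn : 1 ≤ n) (hm : 1 ≤ m) {w w' : Fin (n + m) ≃ Idx n m}
    (hw : IsShuffle w) (hw' : IsShuffle w') (k k' : ℤ)
    (h : extendFrom 𝕜 (shuffleBorel 𝕜 w hw) k = extendFrom 𝕜 (shuffleBorel 𝕜 w' hw') k') :
    borelClass 𝕜 (shuffleBorel 𝕜 w hw) k = borelClass 𝕜 (shuffleBorel 𝕜 w' hw') k' := by
  have h1 := congrArg (fun b : affBorels 𝕜 n m => simpleRoots (b : Submodule 𝕜 (Amb 𝕜 n m))) h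
  simp only [extendFrom_shuffleBorel hn] at h1
  rw [(isPositioning_position hn w k).simpleRoots_borelOf hn hm,
    (isPositioning_position hn w' k').simpleRoots_borelOf hn hm] at h1
  have h2 := fun a => (isPositioning_position hn w k).sub_eq_of_heightOne_eq hn h1
    (Sum.inl ⟨0, hn⟩) a
  set z : Idx n m := Sum.inl ⟨0, hn⟩
  rcases le_total (position w k z) (position w' k' z) with hle | hle
  · refine borelClass_eq_of_position_add 𝕜 hn hw'
      (position w' k' z - position w k z).toNat hw fun a => ?_
    have := h2 a
    omega
  · refine (borelClass_eq_of_position_add 𝕜 hn hw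
      (position w k z - position w' k' z).toNat hw' fun a => ?_).symm
    have := h2 a
    omega

theorem extendFrom_rotate (hn : 1 ≤ n) {w : Fin (n + m) ≃ Idx n m} (hw : IsShuffle w)
    (h : EndsInN w) (k : ℤ) : extendFrom 𝕜 (shuffleBorel 𝕜 w hw) k =
      extendFrom 𝕜 (shuffleBorel 𝕜 (rotate w) (isShuffle_rotate hw h)) (k + 1) := by
  refine Subtype.ext ?_
  rw [extendFrom_shuffleBorel hn, extendFrom_shuffleBorel hn, ← heightOne_add_const 𝕜 _ 1]
  congr 2
  ext a
  exact (position_rotate h k a).symm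

/-- The extension to the affinization, as a map from the set of classes. -/
noncomputable def extendClass (hn : 1 ≤ n) : BorelClasses 𝕜 n m → affBorels 𝕜 n m :=
  Quotient.lift (fun x => extendFrom 𝕜 x.1 x.2) (by
    intro x y hxy
    induction hxy with
    | rel x y h =>
      obtain ⟨w, hw, hend, hx, hy, hk⟩ := h
      have hx' : x.1 = shuffleBorel 𝕜 w hw := Subtype.ext hx
      have hy' : y.1 = shuffleBorel 𝕜 (rotate w) (isShuffle_rotate hw hend) := Subtype.ext hy
      rw [hx', hy', hk]
      exact extendFrom_rotate 𝕜 hn hw hend _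
    | refl x => rfl
    | symm x y _ ih => exact ih.symm
    | trans x y z _ _ ih1 ih2 => exact ih1.trans ih2)

theorem extendClass_bijective (hn : 1 ≤ n) (hm : 1 ≤ m) :
    Function.Bijective (extendClass 𝕜 (m := m) hn) := by
  constructor
  · intro x y h
    induction x using Quotient.inductionOn with | _ x =>
    induction y using Quotient.inductionOn with | _ y =>
    obtain ⟨⟨_, w, hw, rfl⟩, k⟩ := x
    obtain ⟨⟨_, w', hw', rfl⟩, k'⟩ := y
    exact extendFrom_eq_iff 𝕜 hn hm hw hw' k k' h
  · rintro ⟨_, k, _, ⟨b, hb, rfl⟩, rfl⟩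
    exact ⟨borelClass 𝕜 ⟨b, hb⟩ k, rfl⟩

/-- The bijection between affine Borel subalgebras and classes. -/
noncomputable def borelEquiv (hn : 1 ≤ n) (hm : 1 ≤ m) : affBorels 𝕜 n m ≃ BorelClasses 𝕜 n m :=
  (Equiv.ofBijective _ (extendClass_bijective 𝕜 hn hm)).symm

theorem borelEquiv_extendFrom (hn : 1 ≤ n) (hm : 1 ≤ m) (b : finBorels 𝕜 n m) (k : ℤ) :
    borelEquiv 𝕜 hn hm (extendFrom 𝕜 b k) = borelClass 𝕜 b k :=
  (Equiv.ofBijective _ (extendClass_bijective 𝕜 hn hm)).symm_apply_apply (borelClass 𝕜 b k)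

end Rotation

/-! ### Odd reflections as interchanges of neighbouring positions -/

section Reflection

/-- The positions `f'` arise from `f` by interchanging two neighbours, of which `a` comes first. -/
structure IsTransposed {X : Type*} (f f' : X → ℤ) (a c : X) : Prop where
  fst : f' a = f a + 1
  snd : f' c = f c - 1
  other : ∀ x, x ≠ a → x ≠ c → f' x = f x

theorem IsTransposed.symm {X : Type*} {f f' : X → ℤ} {a c : X} (h : IsTransposed f f' a c) :
    IsTransposed f' f c a :=
  ⟨by rw [h.snd]; ring, by rw [h.fst]; ring, fun x hc ha => (h.other x ha hc).symm⟩

/-- Reflecting the set of simple roots amounts to interchanging two neighbouring positions. -/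
theorem reflect_heightOne {X M : Type*} [AddCommGroup M] (φ : X → X → ℤ → M) (N : ℤ)
    (hadd : ∀ a b c s t, φ a b s + φ b c t = φ a c (s + t))
    (hneg : ∀ a b s, -φ a b s = φ b a (-s))
    (hsep : ∀ a b c d u v s t r, φ a b s + φ c d t = φ u v r →
      ∀ g : X → ℤ, g b - g a + (g d - g c) = g v - g u)
    (hshift : ∀ a b s t, N * s = N * t → φ a b s = φ a b t)
    (hN1 : ∀ t, N * t ≠ 1) (hN2 : ∀ t, N * t ≠ 2)
    (Δ : Set M) (hΔ : ∀ a b s, a ≠ b → φ a b s ∈ Δ) (hΔ' : ∀ x ∈ Δ, ∃ u v r, x = φ u v r)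
    {f f' : X → ℤ} (hf : ∀ a b t, f a = f b + N * t → a = b) {a c : X} {s : ℤ}
    (hs : f c - f a + N * s = 1) (hff : IsTransposed f f' a c) :
    reflect Δ (φ a c s) {α | ∃ x y t, f y - f x + N * t = 1 ∧ α = φ x y t} =
      {α | ∃ x y t, f' y - f' x + N * t = 1 ∧ α = φ x y t} := by
  classical
  have hfst := hff.fst
  have hsnd := hff.snd
  have hac : a ≠ c := by
    rintro rfl
    exact hN1 s (by linarith)
  -- The separation hypothesis for sums also handles single terms, on adding the trivial term `φ b b
  -- 0`.
  have hsep1 : ∀ a b u v s r, φ a b s = φ u v r → ∀ g : X → ℤ, g b - g a = g v - g u := by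
    intro a b u v s r h g
    have h1 := hsep a b b b u v s 0 r (by rw [hadd, add_zero, h]) g
    linarith
  have hne : ∀ x y t, (x ≠ a ∨ y ≠ c) → x ≠ y → φ x y t ≠ φ a c s := by
    intro x y t h hxy he
    rcases h with h | h
    · have := hsep1 _ _ _ _ _ _ he (fun z => if z = x then 1 else 0)
      simp only [if_pos, hxy.symm, h.symm, if_false] at this
      split_ifs at this <;> omega
    · have := hsep1 _ _ _ _ _ _ he (fun z => if z = y then 1 else 0)
      simp only [if_pos, hxy, h.symm, if_false] at this
      split_ifs at this <;> omega
  have hnot : ∀ x y t, x ≠ a → x ≠ c → y ≠ a → y ≠ c → x ≠ y → φ a c s + φ x y t ∉ Δ := by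
    intro x y t hxa hxc hya hyc hxy hmem
    obtain ⟨u, v, r, h⟩ := hΔ' _ hmem
    -- The indicator of the two end points takes the value 2 on the sum, whereas on a single
    -- difference it is at most 1.
    have := hsep _ _ _ _ _ _ _ _ _ h (fun z => if z = c ∨ z = y then 1 else 0)
    simp only [hac, hya.symm, hxc, hxy, true_or, or_true, or_self, if_true, if_false] at this
    split_ifs at this <;> omega
  have hself : ∀ x y t, f y - f x + N * t = 1 → x ≠ y := by
    rintro x y t h rfl
    exact hN1 t (by linarith)
  have hself' : ∀ x y t, f' y - f' x + N * t = 1 → x ≠ y := by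
    rintro x y t h rfl
    exact hN1 t (by linarith)
  ext δ
  constructor
  · rintro ⟨_, ⟨x, y, t, ht, rfl⟩, ⟨_, rfl⟩ | ⟨hne', hmem, rfl⟩ | ⟨hne', hmem, rfl⟩⟩
    · exact ⟨c, a, -s, by rw [hfst, hsnd]; linarith, hneg _ _ _⟩
    all_goals
      have hxy := hself x y t ht
      have hxa : x ≠ a := by
        rintro rfl
        have hyc : y = c := hf y c (s - t) (by linarith)
        subst hyc
        exact hne' (hshift _ _ _ _ (by linarith))
      have hyc : y ≠ c := by
        rintro rfl
        exact hxa (hf x a (t - s) (by linarith))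
    · by_cases hya : y = a
      · subst hya
        have hxc : x ≠ c := by
          rintro rfl
          -- If `c` followed `a` and `a` followed `c`, two steps would make up a full multiple of
          -- the period.
          exact hN2 (s + t) (by linarith)
        refine ⟨x, c, t + s, ?_, by rw [add_comm, hadd]⟩
        rw [hsnd, hff.other x hxa hxc]
        linarith
      · by_cases hxc : x = c
        · subst hxc
          refine ⟨a, y, s + t, ?_, hadd _ _ _ _ _⟩
          rw [hfst, hff.other y hya hyc]
          linarith
        · exact absurd hmem (hnot x y t hxa hxc hya hyc hxy)
    · by_cases hya : y = a
      · subst hya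
        have hxc : x ≠ c := by
          rintro rfl
          exact hN2 (s + t) (by linarith)
        refine absurd ?_ hmem
        rw [add_comm, hadd]
        exact hΔ _ _ _ hxc
      · by_cases hxc : x = c
        · subst hxc
          refine absurd ?_ hmem
          rw [hadd]
          exact hΔ _ _ _ (Ne.symm hya)
        · refine ⟨x, y, t, ?_, rfl⟩
          rw [hff.other x hxa hxc, hff.other y hya hyc]
          exact ht
  · rintro ⟨x, y, t, ht, rfl⟩
    have hxy := hself' x y t ht
    by_cases hca : x = c ∧ y = a
    · obtain ⟨rfl, rfl⟩ := hca
      refine ⟨_, ⟨y, x, s, hs, rfl⟩, Or.inl ⟨rfl, ?_⟩⟩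
      rw [hneg]
      refine hshift _ _ _ _ ?_
      rw [hfst, hsnd] at ht
      linarith
    -- After the interchange `a` comes right after `c`. Any other predecessor of `a`, or successor
    -- of `c`, would have shared its old position modulo `N` with that letter.
    have hf'inj : ∀ t, (x ≠ c → f' y - f' x + N * t = 1 → y ≠ a) ∧
        (y ≠ a → f' y - f' x + N * t = 1 → x ≠ c) := by
      refine fun t => ⟨?_, ?_⟩
      · rintro hxc h rfl
        rw [hfst, hff.other x hxy hxc] at h
        exact hxy (hf x y t (by linarith))
      · rintro hya h rfl
        rw [hsnd, hff.other y hya hxy.symm] at h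
        exact hxy (hf x y t (by linarith))
    have hxc : x ≠ c := fun h => (hf'inj t).2 (fun h' => hca ⟨h, h'⟩) ht h
    have hya : y ≠ a := (hf'inj t).1 hxc ht
    by_cases hxa : x = a
    · subst hxa
      have hyc : y ≠ c := by
        rintro rfl
        rw [hfst, hsnd] at ht
        exact hN2 (t - s) (by linarith)
      rw [hfst, hff.other y hya hyc] at ht
      refine ⟨_, ⟨c, y, t - s, by linarith, rfl⟩, Or.inr (Or.inl ⟨?_, ?_, ?_⟩)⟩
      · exact hne _ _ _ (Or.inl hac.symm) hyc.symm
      · rw [hadd]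
        exact hΔ _ _ _ hxy
      · rw [hadd, add_sub_cancel]
    · by_cases hyc : y = c
      · subst hyc
        rw [hsnd, hff.other x hxa hxy] at ht
        refine ⟨_, ⟨x, a, t - s, by linarith, rfl⟩, Or.inr (Or.inl ⟨?_, ?_, ?_⟩)⟩
        · exact hne _ _ _ (Or.inl hxa) hxa
        · rw [add_comm, hadd]
          exact hΔ _ _ _ hxy
        · rw [add_comm, hadd, sub_add_cancel]
      · rw [hff.other x hxa hxc, hff.other y hya hyc] at ht
        exact ⟨_, ⟨x, y, t, ht, rfl⟩, Or.inr (Or.inr ⟨hne _ _ _ (Or.inl hxa) hxy,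
          hnot x y t hxa hxc hya hyc hxy, rfl⟩)⟩

variable {n m : ℕ}

theorem rootVec_pairing (g : Idx n m → ℤ) (a b : Idx n m) :
    ∑ x, g x * rootVec a b x = g a - g b := by
  simp [rootVec, mul_sub, Finset.sum_sub_distrib, Pi.single_apply]

/-- Brings the finite case into the shape of `reflect_heightOne` with period 0; the variable `t` is
a dummy. -/
theorem finSimple_eq (w : Fin (n + m) ≃ Idx n m) :
    finSimple w = {α | ∃ x y, ∃ t : ℤ,
      ((w.symm y : ℕ) : ℤ) - ((w.symm x : ℕ) : ℤ) + 0 * t = 1 ∧ α = rootVec x y} := by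
  ext α
  constructor
  · rintro ⟨p, q, hpq, rfl⟩
    refine ⟨w p, w q, 0, ?_, rfl⟩
    simp only [Equiv.symm_apply_apply]
    omega
  · rintro ⟨x, y, t, h, rfl⟩
    exact ⟨w.symm x, w.symm y, by omega, by simp⟩

theorem reflect_finSimple {w w' : Fin (n + m) ≃ Idx n m} {p q : Fin (n + m)}
    (hpq : (p : ℕ) + 1 = q)
    (h : IsTransposed (fun x => ((w.symm x : ℕ) : ℤ)) (fun x => ((w'.symm x : ℕ) : ℤ))
      (w p) (w q)) :
    finSimple w' = reflect (finRoots n m) (rootVec (w p) (w q)) (finSimple w) := by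
  rw [finSimple_eq, finSimple_eq]
  refine (reflect_heightOne (fun a b (_ : ℤ) => rootVec a b) 0 (fun a b c _ _ => rootVec_add a b c)
    (fun a b _ => rootVec_neg a b) ?_ (fun _ _ _ _ _ => rfl) (by simp) (by simp) (finRoots n m)
    (fun a b _ hab => ⟨a, b, hab, rfl⟩) ?_ ?_ (s := 0) ?_ h).symm
  · intro a b c d u v _ _ _ h g
    have h1 := congrArg (fun y => ∑ x, g x * y x) h
    simp only [Pi.add_apply, mul_add, Finset.sum_add_distrib, rootVec_pairing] at h1
    linarith
  · rintro x ⟨a, b, _, rfl⟩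
    exact ⟨a, b, 0, rfl⟩
  · intro a b t hab
    exact w.symm.injective (Fin.ext (by simpa using hab))
  · simp only [Equiv.symm_apply_apply]
    omega

variable {𝕜 : Type*} [Field 𝕜]

/-- A height drops only for differences starting at `a` or ending at `c`. If just one of these
happens, it drops by at most 1 and was at least 2, since neighbours are unique. If both happen, the
root differs from the reflected one by a positive number of periods, so its height is at least 3 and
drops by 2. -/
theorem IsPositioning.mem_heightPos_of_isTransposed (hn : 1 ≤ n) (hm : 1 ≤ m) {f f' : Idx n m → ℤ}
    (hf : IsPositioning f) {a c : Idx n m} {s : ℤ} (hs : height f a c s = 1)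
    (h : IsTransposed f f' a c) {α : Wt 𝕜 n m} (hα : α ∈ heightPos 𝕜 f)
    (hne : α ≠ affRoot 𝕜 (rootVec a c) s) : α ∈ heightPos 𝕜 f' := by
  obtain ⟨u, v, t, ht, rfl⟩ := hα
  refine ⟨u, v, t, ?_, rfl⟩
  have hfst := h.fst
  have hsnd := h.snd
  unfold height at hs ht ⊢
  have huv : u = a → v = c → 1 ≤ t - s := by
    rintro rfl rfl
    have h1 : t ≠ s := by
      rintro rfl
      exact hne rfl
    by_contra! hc
    have := mul_le_mul_of_nonneg_left (show t - s ≤ -1 by omega)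
      (show (0 : ℤ) ≤ (n : ℤ) + m by omega)
    linarith [show ((n : ℤ) + m) ≥ 2 by omega]
  by_cases hu : u = a <;> by_cases hv : v = c
  · have h1 := huv hu hv
    subst hu hv
    rw [hfst, hsnd]
    have := mul_le_mul_of_nonneg_left h1 (show (0 : ℤ) ≤ (n : ℤ) + m by omega)
    linarith [show ((n : ℤ) + m) ≥ 2 by omega]
  · have h1 : f v - f u + ((n : ℤ) + m) * t ≠ 1 := by
      subst hu
      intro h1
      exact hv (hf.inj v c (s - t) (by linarith))
    have h2 : f' v ≥ f v := by
      by_cases hva : v = a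
      · rw [hva, hfst]; omega
      · rw [h.other v hva hv]
    rw [hu] at h1 ht ⊢
    omega
  · have h1 : f v - f u + ((n : ℤ) + m) * t ≠ 1 := by
      subst hv
      intro h1
      exact hu (hf.inj u a (t - s) (by linarith))
    have h2 : f' u ≤ f u := by
      by_cases huc : u = c
      · rw [huc, hsnd]; omega
      · rw [h.other u hu huc]
    rw [hv] at h1 ht ⊢
    omega
  · have h1 : f' v ≥ f v := by
      by_cases hva : v = a
      · rw [hva, hfst]; omega
      · rw [h.other v hva hv]
    have h2 : f' u ≤ f u := by
      by_cases huc : u = c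
      · rw [huc, hsnd]; omega
      · rw [h.other u hu huc]
    omega

variable [CharZero 𝕜]

/-- The period must be at least 3: for `n = m = 1` the two simple roots add up to the root
`deltaBar`, and the reflection rule gives a wrong answer. -/
theorem IsPositioning.reflect_heightOne (hn : 1 ≤ n) (hm : 2 ≤ m) {f f' : Idx n m → ℤ}
    (hf : IsPositioning f) {a c : Idx n m} {s : ℤ} (hs : height f a c s = 1)
    (h : IsTransposed f f' a c) :
    heightOne 𝕜 f' =
      reflect (rootsOf (affAlg 𝕜 n m)) (affRoot 𝕜 (rootVec a c) s) (heightOne 𝕜 f) := by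
  have hN : ∀ t : ℤ, ((n : ℤ) + m) * t ≠ 1 ∧ ((n : ℤ) + m) * t ≠ 2 := by
    intro t
    rcases lt_or_ge 0 t with ht | ht
    · have := mul_le_mul_of_nonneg_left (show (1 : ℤ) ≤ t from ht)
        (show (0 : ℤ) ≤ (n : ℤ) + m by omega)
      constructor <;> omega
    · have := mul_le_mul_of_nonneg_left ht (show (0 : ℤ) ≤ (n : ℤ) + m by omega)
      constructor <;> omega
  refine (AffineBorel.reflect_heightOne (fun a b s => affRoot 𝕜 (rootVec a b) s) ((n : ℤ) + m)
    (fun a b c s t => affRoot_rootVec_add a b c s t)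
    (fun a b s => by rw [affRoot_neg, rootVec_neg])
    (fun a b c d u v s t r h g => by simpa using affRoot_add_separates h g 0)
    (fun a b s t h => by rw [mul_left_cancel₀ (by omega) h])
    (fun t => (hN t).1) (fun t => (hN t).2) _
    (fun a b s hab => affRoot_mem_rootsOf hn (by omega) (Or.inl hab)) ?_ hf.inj hs h).symm
  intro x hx
  rw [rootsOf_affAlg hn (by omega)] at hx
  exact hx.2

theorem height_neg (f : Idx n m → ℤ) (a c : Idx n m) (s : ℤ) :
    height f c a (-s) = -height f a c s := by
  unfold height
  ring

theorem IsTransposed.height {f f' : Idx n m → ℤ} {a c : Idx n m} {s : ℤ}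
    (hs : height f a c s = 1) (h : IsTransposed f f' a c) : AffineBorel.height f' c a (-s) = 1 := by
  unfold AffineBorel.height at *
  rw [h.fst, h.snd]
  linarith

/-- The two inclusions are `IsPositioning.mem_heightPos_of_isTransposed` for the interchange and for
its inverse. -/
theorem IsPositioning.heightPos_of_isTransposed (hn : 1 ≤ n) (hm : 1 ≤ m) {f f' : Idx n m → ℤ}
    (hf : IsPositioning f) (hf' : IsPositioning f') {a c : Idx n m} {s : ℤ}
    (hs : height f a c s = 1) (h : IsTransposed f f' a c) :
    heightPos 𝕜 f' = insert (-affRoot 𝕜 (rootVec a c) s)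
      (heightPos 𝕜 f \ {affRoot 𝕜 (rootVec a c) s}) := by
  have hneg : -affRoot 𝕜 (rootVec a c) s = affRoot 𝕜 (rootVec c a) (-s) := by
    rw [affRoot_neg, rootVec_neg]
  have hs' := h.height hs
  ext α
  constructor
  · intro hα
    by_cases he : α = -affRoot 𝕜 (rootVec a c) s
    · exact Or.inl he
    · refine Or.inr ⟨hf'.mem_heightPos_of_isTransposed hn hm hs' h.symm hα (hneg ▸ he), ?_⟩
      rintro rfl
      rw [mem_heightPos_iff] at hα
      have := height_neg f' a c s
      omega
  · rintro (rfl | ⟨hα, hne⟩)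
    · rw [hneg, mem_heightPos_iff]
      omega
    · exact hf.mem_heightPos_of_isTransposed hn hm hs h hα hne

theorem IsPositioning.adjacentBorel_eq (hn : 1 ≤ n) (hm : 1 ≤ m) {f f' : Idx n m → ℤ}
    (hf : IsPositioning f) (hf' : IsPositioning f') {a c : Idx n m} {s : ℤ}
    (hs : height f a c s = 1) (h : IsTransposed f f' a c) :
    adjacentBorel (affRoot 𝕜 (rootVec a c) s) (borelOf (heightOne 𝕜 f)) =
      borelOf (heightOne 𝕜 f') := by
  rw [hf'.borelOf_eq hn hm, hf.heightPos_of_isTransposed hn hm hf' hs h, iSup_insert,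
    adjacentBorel, hf.rootsOf_borelOf hn hm, sup_assoc, sup_comm (rootSpace _)]

end Reflection

/-! ### Parity and interchanges inside a window -/

section Windows

variable {n m : ℕ}

theorem nuRoot_rootVec (j : ℤ) (a b : Idx n m) :
    nuRoot j (rootVec a b) = rootVec ((nu n m ^ j) a) ((nu n m ^ j) b) := by
  have h : ∀ a x : Idx n m, (Pi.single a 1 : Idx n m → ℤ) ((nu n m ^ (-j)) x) =
      (Pi.single ((nu n m ^ j) a) 1 : Idx n m → ℤ) x := by
    intro a x
    simp only [Pi.single_apply, zpow_neg, Equiv.Perm.inv_eq_iff_eq]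
  ext x
  simp only [nuRoot, rootVec, Pi.sub_apply, h]

theorem nuRoot_neg (j : ℤ) (v : Idx n m → ℤ) : nuRoot j (-v) = -nuRoot j v := rfl

theorem eq_rootVec_globalIdx {j : ℤ} {v : Idx n m → ℤ} {a b : Idx n m}
    (h : nuRoot j v = rootVec a b) : v = rootVec (globalIdx j a) (globalIdx j b) := by
  have h1 : v = nuRoot (-j) (nuRoot j v) := by
    ext x
    simp only [nuRoot, ← Equiv.Perm.mul_apply, ← zpow_add]
    simp
  rw [h1, h, nuRoot_rootVec]
  rfl

theorem sgn_ne_of_isotropic {a b : Idx n m} (hab : a ≠ b)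
    (h : rootForm (rootVec a b) (rootVec a b) = 0) : sgn a ≠ sgn b := by
  intro he
  have h1 : rootForm (rootVec a b) (rootVec a b) = sgn a + sgn b := by
    rw [rootForm, rootVec_pairing (fun x => sgn x * rootVec a b x)]
    simp [rootVec, hab, hab.symm]
  rw [h1, he] at h
  rcases b with i | i <;> simp [sgn] at h

theorem sgn_nu_zpow (k : ℤ) (a : Idx n m) : sgn ((nu n m ^ k) a) = sgn a := by
  rcases a with i | j
  · obtain ⟨i', h, _⟩ := nu_zpow_inl (m := m) k i
    rw [h]
    rfl
  · rw [nu_zpow_inr]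

theorem IsoRoot.exists_rootVec (α : IsoRoot n m) :
    ∃ a b, a ≠ b ∧ α.vec = rootVec a b ∧ sgn a ≠ sgn b := by
  obtain ⟨a, b, hab, h⟩ := α.isRoot
  exact ⟨a, b, hab, h, sgn_ne_of_isotropic hab (h ▸ α.isotropic)⟩

theorem IsoRoot.neg_vec_ne (α : IsoRoot n m) : -α.vec ≠ α.vec := by
  obtain ⟨a, b, hab, h, _⟩ := α.exists_rootVec
  intro hc
  have := congrFun hc a
  rw [h] at this
  simp [rootVec, hab] at this

theorem IsoRoot.sgn_ne (α : IsoRoot n m) {j : ℤ} {x y : Idx n m} (hxy : x ≠ y)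
    (h : nuRoot j α.vec = rootVec x y) : sgn x ≠ sgn y := by
  have h1 := eq_rootVec_globalIdx h
  have h2 := sgn_ne_of_isotropic (fun hc => hxy (globalIdx_injective j hc)) (h1 ▸ α.isotropic)
  simpa only [globalIdx, sgn_nu_zpow] using h2

theorem isTransposed_swap (w : Fin (n + m) ≃ Idx n m) {p q : Fin (n + m)}
    (hpq : (p : ℕ) + 1 = q) :
    IsTransposed (fun x => ((w.symm x : ℕ) : ℤ))
      (fun x => ((((Equiv.swap p q).trans w).symm x : ℕ) : ℤ)) (w p) (w q) where
  fst := by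
    simp
    omega
  snd := by
    simp
    omega
  other x hp hq := by
    simp only [Equiv.symm_trans_apply, Equiv.symm_swap]
    rw [Equiv.swap_apply_of_ne_of_ne]
    · rintro rfl
      simp at hp
    · rintro rfl
      simp at hq

/-- The shift depends on the letter and on `k` but not on the word, so an interchange of places is
one of positions. -/
theorem IsTransposed.position {w w' : Fin (n + m) ≃ Idx n m} {a c : Idx n m}
    (h : IsTransposed (fun x => ((w.symm x : ℕ) : ℤ)) (fun x => ((w'.symm x : ℕ) : ℤ)) a c)
    (k : ℤ) : IsTransposed (position w k) (position w' k) (globalIdx k a) (globalIdx k c) where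
  fst := by
    rw [position_globalIdx, position_globalIdx, h.fst]
    ring
  snd := by
    rw [position_globalIdx, position_globalIdx, h.snd]
    ring
  other x ha hc := by
    rw [← globalIdx_nu_zpow k x] at ha hc ⊢
    rw [position_globalIdx, position_globalIdx,
      h.other _ (fun he => ha (by rw [he])) (fun he => hc (by rw [he]))]

/-- Only the relative order of the two neighbours changes, and these are of opposite parity, so the
order within each kind of letter is kept. -/
theorem isShuffle_swap {w : Fin (n + m) ≃ Idx n m} (hw : IsShuffle w) {p q : Fin (n + m)}
    (hpq : (p : ℕ) + 1 = q) (hs : sgn (w p) ≠ sgn (w q)) :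
    IsShuffle ((Equiv.swap p q).trans w) := by
  have h := isTransposed_swap w hpq
  have key : ∀ x y : Idx n m, sgn x = sgn y → w.symm x < w.symm y →
      ((Equiv.swap p q).trans w).symm x < ((Equiv.swap p q).trans w).symm y := by
    intro x y hxy hlt
    have hle : ∀ z, z ≠ w p → z ≠ w q →
        ((((Equiv.swap p q).trans w).symm z : ℕ) : ℤ) = (w.symm z : ℕ) := h.other
    have hfst : ((((Equiv.swap p q).trans w).symm (w p) : ℕ) : ℤ) = (w.symm (w p) : ℕ) + 1 := h.fst
    have hsnd : ((((Equiv.swap p q).trans w).symm (w q) : ℕ) : ℤ) = (w.symm (w q) : ℕ) - 1 := h.snd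
    rw [Equiv.symm_apply_apply] at hfst hsnd
    rw [Fin.lt_def] at hlt ⊢
    have hinj : ∀ z : Idx n m, ∀ r, z ≠ w r → (w.symm z : ℕ) ≠ r := by
      intro z r hz he
      exact hz (by rw [← Fin.ext he, Equiv.apply_symm_apply])
    by_cases hxp : x = w p
    · have hyq : y ≠ w q := by
        rintro rfl
        exact hs (hxp ▸ hxy)
      have hyp : y ≠ w p := by
        rintro rfl
        rw [hxp] at hlt
        exact lt_irrefl _ hlt
      have h1 := hle y hyp hyq
      have h2 := hinj y q hyq
      rw [hxp, Equiv.symm_apply_apply] at hlt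
      rw [hxp]
      omega
    · by_cases hxq : x = w q
      · have hyq : y ≠ w q := by
          rintro rfl
          rw [hxq] at hlt
          exact lt_irrefl _ hlt
        have hyp : y ≠ w p := by
          rintro rfl
          exact hs (hxq ▸ hxy.symm)
        have h1 := hle y hyp hyq
        rw [hxq, Equiv.symm_apply_apply] at hlt
        rw [hxq]
        omega
      · have h1 := hle x hxp hxq
        have h2 := hinj x p hxp
        by_cases hyp : y = w p
        · rw [hyp, Equiv.symm_apply_apply] at hlt
          rw [hyp]
          omega
        · by_cases hyq : y = w q
          · rw [hyq, Equiv.symm_apply_apply] at hlt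
            rw [hyq]
            omega
          · have h3 := hle y hyp hyq
            omega
  exact ⟨fun i j hij => key _ _ rfl (hw.1 i j hij), fun i j hij => key _ _ rfl (hw.2 i j hij)⟩

end Windows

/-! ### Odd reflections of affine Borel subalgebras through windows -/

section OddReflections

variable {𝕜 : Type*} [Field 𝕜] {n m : ℕ}

theorem exists_extendFrom (b : affBorels 𝕜 n m) :
    ∃ (w : Fin (n + m) ≃ Idx n m) (hw : IsShuffle w) (k : ℤ),
      b = extendFrom 𝕜 (shuffleBorel 𝕜 w hw) k := by
  obtain ⟨_, k, _, ⟨_, ⟨w, hw, rfl⟩, rfl⟩, rfl⟩ := b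
  exact ⟨w, hw, k, rfl⟩

variable [CharZero 𝕜]

theorem simpleRoots_extendFrom (hn : 1 ≤ n) (hm : 1 ≤ m) (w : Fin (n + m) ≃ Idx n m)
    (hw : IsShuffle w) (k : ℤ) :
    simpleRoots (extendFrom 𝕜 (shuffleBorel 𝕜 w hw) k : Submodule 𝕜 (Amb 𝕜 n m)) =
      heightOne 𝕜 (position w k) := by
  rw [extendFrom_shuffleBorel hn, (isPositioning_position hn w k).simpleRoots_borelOf hn hm]

/-- An isotropic simple root of an affine Borel subalgebra is, for a suitable choice of `w` and
`j`, a simple root of the Borel subalgebra of `localAlg j` attached to `w`. -/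
theorem exists_window (hn : 1 ≤ n) (hm : 1 ≤ m) (b : affBorels 𝕜 n m) (α : IsoRoot n m) (s : ℤ)
    (hs : affRoot 𝕜 α.vec s ∈ simpleRoots (b : Submodule 𝕜 (Amb 𝕜 n m))) :
    ∃ (w : Fin (n + m) ≃ Idx n m) (hw : IsShuffle w) (j : ℤ) (p q : Fin (n + m)),
      (p : ℕ) + 1 = q ∧ nuRoot j α.vec = rootVec (w p) (w q) ∧
      b = extendFrom 𝕜 (shuffleBorel 𝕜 w hw) j := by
  obtain ⟨w, hw, k, rfl⟩ := exists_extendFrom b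
  obtain ⟨a, c, hac, hα, hsgn⟩ := α.exists_rootVec
  rw [simpleRoots_extendFrom hn hm, hα, mem_heightOne_iff] at hs
  have hpos := height_position w k ((nu n m ^ k) a) ((nu n m ^ k) c)
    (s - (shift k ((nu n m ^ k) a) - shift k ((nu n m ^ k) c)))
  rw [globalIdx_nu_zpow, globalIdx_nu_zpow, add_sub_cancel, hs] at hpos
  have hx : ∀ l, nuRoot l α.vec = rootVec ((nu n m ^ l) a) ((nu n m ^ l) c) := fun l => by
    rw [hα, nuRoot_rootVec]
  have hxy : sgn ((nu n m ^ k) a) ≠ sgn ((nu n m ^ k) c) := by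
    rwa [sgn_nu_zpow, sgn_nu_zpow]
  have hk := hx k
  set x := (nu n m ^ k) a with hxdef
  set y := (nu n m ^ k) c with hydef
  set t := s - (shift k x - shift k y)
  have hcases : t = 0 ∨ t = 1 := by
    have h1 : t < 2 := by
      by_contra! hc
      have := mul_le_mul_of_nonneg_left hc (show (0 : ℤ) ≤ (n : ℤ) + m by omega)
      omega
    have h2 : -1 < t := by
      by_contra! hc
      have := mul_le_mul_of_nonneg_left hc (show (0 : ℤ) ≤ (n : ℤ) + m by omega)
      omega
    omega
  rcases hcases with ht | ht
  · rw [ht] at hpos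
    exact ⟨w, hw, k, w.symm x, w.symm y, by omega, by simpa using hk, rfl⟩
  rw [ht] at hpos
  have hxl : (w.symm x : ℕ) + 1 = n + m := by omega
  have hyf : (w.symm y : ℕ) = 0 := by omega
  -- Here `t = 1`: `x` closes the window and `y` opens the next one. If `x` is unprimed, a rotation
  -- carries it to the front, right before `y`.
  rcases hxe : x with i | j
  · have hend : EndsInN w := by
      refine ⟨w.symm x, i, hxl, ?_, by rw [Equiv.apply_symm_apply, hxe]⟩
      by_contra hne
      have h1 := hw.1 i ⟨i + 1, by omega⟩ (by rw [Fin.lt_def]; simp)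
      rw [← hxe, Fin.lt_def] at h1
      omega
    have h1 := rotate_symm_nu w x
    have h2 := rotate_symm_nu w y
    have h3 : ((rotate w).symm (nu n m x) : ℕ) = 0 := by
      rw [h1, finRotate_val_of_eq hxl]
    have h4 : ((rotate w).symm (nu n m y) : ℕ) = 1 := by
      rw [h2, finRotate_val_of_lt (by omega), hyf]
    refine ⟨rotate w, isShuffle_rotate hw hend, k + 1, (rotate w).symm (nu n m x),
      (rotate w).symm (nu n m y), by omega, ?_, extendFrom_rotate 𝕜 hn hw hend k⟩
    rw [hx, Equiv.apply_symm_apply, Equiv.apply_symm_apply, add_comm k 1, zpow_add,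
      Equiv.Perm.mul_apply, Equiv.Perm.mul_apply, zpow_one]
  -- If `x` is primed, then `y` is unprimed by parity. Undoing a rotation carries `y` to the end of
  -- the window, right after `x`.
  · rcases hye : y with i | j'
    · obtain ⟨w, hw', hend, rfl⟩ := exists_rotate_eq hw (p := w.symm y) (i := i) hyf
        (by rw [Equiv.apply_symm_apply, hye])
      have hνx : nu n m ((nu n m ^ (k - 1)) a) = x := by
        rw [hxdef, ← Equiv.Perm.mul_apply, ← zpow_one_add]
        simp
      have hνy : nu n m ((nu n m ^ (k - 1)) c) = y := by
        rw [hydef, ← Equiv.Perm.mul_apply, ← zpow_one_add]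
        simp
      rw [← hνx, rotate_symm_nu] at hxl
      rw [← hνy, rotate_symm_nu] at hyf
      refine ⟨w, hw', k - 1, w.symm ((nu n m ^ (k - 1)) a), w.symm ((nu n m ^ (k - 1)) c), ?_,
        by simpa using hx (k - 1), ?_⟩
      · have h1 : (w.symm ((nu n m ^ (k - 1)) c) : ℕ) + 1 = n + m := by
          by_contra hne
          rw [finRotate_val_of_lt (by omega)] at hyf
          omega
        have h2 : (w.symm ((nu n m ^ (k - 1)) a) : ℕ) + 1 ≠ n + m := by
          intro he
          rw [finRotate_val_of_eq he] at hxl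
          omega
        rw [finRotate_val_of_lt (by omega)] at hxl
        omega
      · rw [extendFrom_rotate 𝕜 hn hw' hend (k - 1)]
        simp only [sub_add_cancel]
    · rw [hxe, hye] at hxy
      exact absurd rfl hxy

variable (𝕜) in
/-- `b'` is adjacent to `b` along a simple root of the form `v + s • deltaBar`. -/
def OddAdjacent (v : Idx n m → ℤ) (b b' : affBorels 𝕜 n m) : Prop :=
  ∃ s : ℤ, affRoot 𝕜 v s ∈ simpleRoots (b : Submodule 𝕜 (Amb 𝕜 n m)) ∧
    (b' : Submodule 𝕜 (Amb 𝕜 n m)) = adjacentBorel (affRoot 𝕜 v s) b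

/-- The equation that the height is 1 fixes `(n + m) s`. Hence the reflection depends only on the
finite root. -/
theorem affRoot_simple_unique (hn : 1 ≤ n) (hm : 1 ≤ m) (b : affBorels 𝕜 n m) (α : IsoRoot n m)
    {s s' : ℤ} (hs : affRoot 𝕜 α.vec s ∈ simpleRoots (b : Submodule 𝕜 (Amb 𝕜 n m)))
    (hs' : affRoot 𝕜 α.vec s' ∈ simpleRoots (b : Submodule 𝕜 (Amb 𝕜 n m))) : s = s' := by
  obtain ⟨w, hw, k, rfl⟩ := exists_extendFrom b
  obtain ⟨a, c, hac, hα, hsgn⟩ := α.exists_rootVec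
  rw [simpleRoots_extendFrom hn hm, hα, mem_heightOne_iff] at hs hs'
  unfold height at hs hs'
  have h : ((n : ℤ) + m) * s = ((n : ℤ) + m) * s' := by linarith
  exact mul_left_cancel₀ (by omega) h

theorem OddAdjacent.unique (hn : 1 ≤ n) (hm : 1 ≤ m) {α : IsoRoot n m} {b b' b'' : affBorels 𝕜 n m}
    (h : OddAdjacent 𝕜 α.vec b b') (h' : OddAdjacent 𝕜 α.vec b b'') : b' = b'' := by
  obtain ⟨s, hs, h⟩ := h
  obtain ⟨s', hs', h'⟩ := h'
  rw [affRoot_simple_unique hn hm b α hs hs'] at h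
  exact Subtype.ext (h.trans h'.symm)

theorem simple_of_window (hn : 1 ≤ n) (hm : 1 ≤ m) {v : Idx n m → ℤ} {w : Fin (n + m) ≃ Idx n m}
    (hw : IsShuffle w) {j : ℤ} {p q : Fin (n + m)} (hpq : (p : ℕ) + 1 = q)
    (h : nuRoot j v = rootVec (w p) (w q)) :
    affRoot 𝕜 v (shift j (w p) - shift j (w q)) ∈
      simpleRoots (extendFrom 𝕜 (shuffleBorel 𝕜 w hw) j : Submodule 𝕜 (Amb 𝕜 n m)) := by
  rw [simpleRoots_extendFrom hn hm, eq_rootVec_globalIdx h, mem_heightOne_iff,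
    ← add_zero (shift j (w p) - _), height_position]
  simp only [Equiv.symm_apply_apply]
  omega

/-- The link between the two actions: an interchange in the finite word, with `j` fixed, is the
affine odd reflection. -/
theorem oddAdjacent_swap (hn : 1 ≤ n) (hm : 1 ≤ m) {v : Idx n m → ℤ}
    {w w' : Fin (n + m) ≃ Idx n m} (hw : IsShuffle w) (hw' : IsShuffle w') {j : ℤ}
    {p q : Fin (n + m)} (hpq : (p : ℕ) + 1 = q) (h : nuRoot j v = rootVec (w p) (w q))
    (ht : IsTransposed (fun x => ((w.symm x : ℕ) : ℤ)) (fun x => ((w'.symm x : ℕ) : ℤ))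
      (w p) (w q)) :
    OddAdjacent 𝕜 v (extendFrom 𝕜 (shuffleBorel 𝕜 w hw) j)
      (extendFrom 𝕜 (shuffleBorel 𝕜 w' hw') j) := by
  have h1 := simple_of_window (𝕜 := 𝕜) hn hm hw hpq h
  refine ⟨_, h1, ?_⟩
  rw [simpleRoots_extendFrom hn hm, eq_rootVec_globalIdx h, mem_heightOne_iff] at h1
  rw [extendFrom_shuffleBorel hn, extendFrom_shuffleBorel hn]
  conv_rhs => rw [eq_rootVec_globalIdx h]
  exact ((isPositioning_position hn w j).adjacentBorel_eq hn hm
    (isPositioning_position hn w' j) h1 (ht.position j)).symm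

/-- The odd reflection along an isotropic simple root, together with its inverse. -/
theorem exists_oddAdjacent (hn : 1 ≤ n) (hm : 1 ≤ m) (b : affBorels 𝕜 n m) (α : IsoRoot n m)
    (s : ℤ) (hs : affRoot 𝕜 α.vec s ∈ simpleRoots (b : Submodule 𝕜 (Amb 𝕜 n m))) :
    ∃ b', OddAdjacent 𝕜 α.vec b b' ∧ OddAdjacent 𝕜 (-α.vec) b' b ∧
      (2 ≤ m → simpleRoots (b' : Submodule 𝕜 (Amb 𝕜 n m)) =
        reflect (rootsOf (affAlg 𝕜 n m)) (affRoot 𝕜 α.vec s)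
          (simpleRoots (b : Submodule 𝕜 (Amb 𝕜 n m)))) := by
  obtain ⟨w, hw, j, p, q, hpq, h, rfl⟩ := exists_window hn hm b α s hs
  have hsgn := α.sgn_ne (w.injective.ne (by rintro rfl; omega)) h
  have ht := isTransposed_swap w hpq
  have hw' := isShuffle_swap hw hpq hsgn
  have hp : (Equiv.swap p q).trans w p = w q := by simp
  have hq : (Equiv.swap p q).trans w q = w p := by simp
  refine ⟨extendFrom 𝕜 (shuffleBorel 𝕜 _ hw') j, oddAdjacent_swap hn hm hw hw' hpq h ht,
    oddAdjacent_swap hn hm hw' hw hpq ?_ ?_, fun h2 => ?_⟩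
  · rw [nuRoot_neg, h, rootVec_neg, hp, hq]
  · rw [hp, hq]
    exact ht.symm
  · rw [simpleRoots_extendFrom hn hm, eq_rootVec_globalIdx h, mem_heightOne_iff] at hs
    rw [simpleRoots_extendFrom hn hm, simpleRoots_extendFrom hn hm, eq_rootVec_globalIdx h]
    exact (isPositioning_position hn w j).reflect_heightOne hn h2 hs (ht.position j)

end OddReflections

/-! ### The functor of odd reflections and its transport -/

section Functors

variable (𝕜 : Type*) [Field 𝕜] {n m : ℕ}

open Classical in
/-- The Borel subalgebra adjacent to `b` along its simple root of the form `v + s • deltaBar`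
(and `b` itself if there is none). -/
noncomputable def oddReflection (v : Idx n m → ℤ) (b : affBorels 𝕜 n m) : affBorels 𝕜 n m :=
  if h : ∃ b', OddAdjacent 𝕜 v b b' then h.choose else b

/-- The affine Borel subalgebras with a simple root of the form `v + s • deltaBar`. -/
def borelsWith (v : Idx n m → ℤ) : Set (affBorels 𝕜 n m) :=
  {b | ∃ s : ℤ, affRoot 𝕜 v s ∈ simpleRoots (b : Submodule 𝕜 (Amb 𝕜 n m))}

open Classical in
/-- The action of the morphism between `v` and `v' = ± v`. -/
noncomputable def oddAction (v v' : Idx n m → ℤ) (b : affBorels 𝕜 n m) : affBorels 𝕜 n m :=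
  if v' = v then b else oddReflection 𝕜 v b

variable {𝕜}

theorem oddAction_self (v : Idx n m → ℤ) (b : affBorels 𝕜 n m) : oddAction 𝕜 v v b = b :=
  if_pos rfl

variable [CharZero 𝕜]

theorem oddReflection_eq (hn : 1 ≤ n) (hm : 1 ≤ m) {α : IsoRoot n m} {b b' : affBorels 𝕜 n m}
    (h : OddAdjacent 𝕜 α.vec b b') : oddReflection 𝕜 α.vec b = b' := by
  have h1 : ∃ b', OddAdjacent 𝕜 α.vec b b' := ⟨b', h⟩
  rw [oddReflection, dif_pos h1]
  exact h1.choose_spec.unique hn hm h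

theorem oddAction_mem (hn : 1 ≤ n) (hm : 1 ≤ m) {α β : IsoRoot n m} (f : α ⟶ β)
    {b : affBorels 𝕜 n m} (hb : b ∈ borelsWith 𝕜 α.vec) :
    oddAction 𝕜 α.vec β.vec b ∈ borelsWith 𝕜 β.vec := by
  unfold oddAction
  split_ifs with h
  · rwa [h]
  · obtain ⟨s, hs⟩ := hb
    obtain ⟨b', h1, ⟨s', h2, _⟩, _⟩ := exists_oddAdjacent hn hm b α s hs
    rw [oddReflection_eq hn hm h1, f.down.resolve_left h]
    exact ⟨s', h2⟩

/-- Morphisms of isotropic roots carry no data beyond their end points, so the only case with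
content is a reflection followed by the one along the opposite root, which is undone by
`exists_oddAdjacent`. -/
theorem oddAction_comp (hn : 1 ≤ n) (hm : 1 ≤ m) {α β γ : IsoRoot n m} (f : α ⟶ β) (g : β ⟶ γ)
    {b : affBorels 𝕜 n m} (hb : b ∈ borelsWith 𝕜 α.vec) :
    oddAction 𝕜 β.vec γ.vec (oddAction 𝕜 α.vec β.vec b) = oddAction 𝕜 α.vec γ.vec b := by
  by_cases h : β.vec = α.vec
  · simp [oddAction, h]
  · by_cases h' : γ.vec = β.vec
    · simp [oddAction, h']
    · have h1 := f.down.resolve_left h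
      have h2 := g.down.resolve_left h'
      have h3 : γ.vec = α.vec := by rw [h2, h1, neg_neg]
      obtain ⟨s, hs⟩ := hb
      obtain ⟨b', hb1, hb2, _⟩ := exists_oddAdjacent hn hm b α s hs
      rw [← h1] at hb2
      rw [oddAction, if_neg h', oddAction, if_neg h, oddAction, if_pos h3,
        oddReflection_eq hn hm hb1, oddReflection_eq hn hm hb2]

variable (𝕜) in
/-- The functor given by odd reflections. -/
noncomputable def oddFunctor (hn : 1 ≤ n) (hm : 1 ≤ m) : IsoRoot n m ⥤ Sym (affBorels 𝕜 n m) where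
  obj α := ⟨borelsWith 𝕜 α.vec⟩
  map {α β} f :=
    { toFun := fun b => ⟨oddAction 𝕜 α.vec β.vec b.1, oddAction_mem hn hm f b.2⟩
      invFun := fun b => ⟨oddAction 𝕜 β.vec α.vec b.1, oddAction_mem hn hm (Groupoid.inv f) b.2⟩
      left_inv := fun b => Subtype.ext 
        ((oddAction_comp hn hm f (Groupoid.inv f) b.2).trans (oddAction_self _ _))
      right_inv := fun b => Subtype.ext 
        ((oddAction_comp hn hm (Groupoid.inv f) f b.2).trans (oddAction_self _ _)) }
  map_id _ := Equiv.ext fun _ => Subtype.ext (oddAction_self _ _)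
  map_comp f g := Equiv.ext fun b => Subtype.ext (oddAction_comp hn hm f g b.2).symm

theorem act_oddFunctor (hn : 1 ≤ n) (hm : 1 ≤ m) (α : IsoRoot n m)
    (b : ((oddFunctor 𝕜 hn hm).obj α).carrier) {b' : affBorels 𝕜 n m}
    (h : OddAdjacent 𝕜 α.vec b.1 b') : (act (oddFunctor 𝕜 hn hm) (rho α) b).1 = b' := by
  change oddAction 𝕜 α.vec (-α.vec) b.1 = b'
  rw [oddAction, if_neg α.neg_vec_ne, oddReflection_eq hn hm h]

theorem act_comp_symMap {C : Type*} [Category C] {X Y : Type*} (F : C ⥤ Sym X) (e : X ≃ Y)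
    {a b : C} (f : a ⟶ b) (q : ((F ⋙ symMap e).obj a).carrier) (x : (F.obj a).carrier)
    (hx : e x.1 = q.1) : (act (F ⋙ symMap e) f q).1 = e (act F f x).1 := by
  obtain rfl : q = e.image (F.obj a).carrier x := Subtype.ext hx.symm
  change e (act F f ((e.image _).symm (e.image _ x))).1 = _
  rw [Equiv.symm_apply_apply]

end Functors

end AffineBorel

open AffineBorel in
theorem theorem4 (𝕜 : Type*) [Field 𝕜] [IsAlgClosed 𝕜] [CharZero 𝕜] (n m : ℕ)
    (hn : 1 ≤ n) (hnm : n ≤ m) :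
    ∃ (e : affBorels 𝕜 n m ≃ BorelClasses 𝕜 n m)
      (R : IsoRoot n m ⥤ Sym (affBorels 𝕜 n m))
      (B : IsoRoot n m ⥤ Sym (BorelClasses 𝕜 n m)),
      -- the bijection
      (∀ (b : finBorels 𝕜 n m) (k : ℤ), e (extendFrom 𝕜 b k) = borelClass 𝕜 b k) ∧
      -- the action on the affine Borel subalgebras is by odd reflections
      (∀ α : IsoRoot n m, (R.obj α).carrier =
        {b : affBorels 𝕜 n m | ∃ s : ℤ,
          affRoot 𝕜 α.vec s ∈ simpleRoots (b : Submodule 𝕜 (Amb 𝕜 n m))}) ∧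
      (∀ (α : IsoRoot n m) (b : (R.obj α).carrier) (s : ℤ),
        affRoot 𝕜 α.vec s ∈ simpleRoots (b.1 : Submodule 𝕜 (Amb 𝕜 n m)) →
        ((act R (rho α) b).1 : Submodule 𝕜 (Amb 𝕜 n m)) =
          adjacentBorel (affRoot 𝕜 α.vec s) b.1 ∧
        (2 ≤ m → simpleRoots ((act R (rho α) b).1 : Submodule 𝕜 (Amb 𝕜 n m)) =
          reflect (rootsOf (affAlg 𝕜 n m)) (affRoot 𝕜 α.vec s)
            (simpleRoots (b.1 : Submodule 𝕜 (Amb 𝕜 n m))))) ∧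
      -- the action on the equivalence classes
      (∀ α : IsoRoot n m, (B.obj α).carrier =
        ⋃ j : ℤ, {q | ∃ (w : Fin (n + m) ≃ Idx n m) (hw : IsShuffle w),
          nuRoot j α.vec ∈ finSimple w ∧ q = borelClass 𝕜 (shuffleBorel 𝕜 w hw) j}) ∧
      (∀ (α : IsoRoot n m) (j : ℤ) (w : Fin (n + m) ≃ Idx n m) (hw : IsShuffle w)
        (q : (B.obj α).carrier), nuRoot j α.vec ∈ finSimple w →
        q.1 = borelClass 𝕜 (shuffleBorel 𝕜 w hw) j →
        ∃ (w' : Fin (n + m) ≃ Idx n m) (hw' : IsShuffle w'),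
          finSimple w' = reflect (finRoots n m) (nuRoot j α.vec) (finSimple w) ∧
          (act B (rho α) q).1 = borelClass 𝕜 (shuffleBorel 𝕜 w' hw') j) ∧
      -- the diagram commutes
      R ⋙ symMap e = B := by
  have hm : 1 ≤ m := hn.trans hnm
  -- The second functor is taken to be the transport of the first, so the diagram commutes by
  -- construction; what has to be proved is its description by finite reflections.
  refine ⟨borelEquiv 𝕜 hn hm, oddFunctor 𝕜 hn hm, oddFunctor 𝕜 hn hm ⋙ symMap (borelEquiv 𝕜 hn hm),
    borelEquiv_extendFrom 𝕜 hn hm, fun _ => rfl, ?_, ?_, ?_, rfl⟩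
  · intro α b s hs
    obtain ⟨b', h1, _, h3⟩ := exists_oddAdjacent hn hm b.1 α s hs
    rw [act_oddFunctor hn hm α b h1]
    refine ⟨?_, h3⟩
    obtain ⟨s', hs', h⟩ := h1
    rw [h, affRoot_simple_unique hn hm b.1 α hs hs']
  · intro α
    change borelEquiv 𝕜 hn hm '' borelsWith 𝕜 α.vec = _
    ext x
    simp only [Set.mem_iUnion]
    constructor
    · rintro ⟨b, ⟨s, hs⟩, rfl⟩
      obtain ⟨w, hw, j, p, q, hpq, h, rfl⟩ := exists_window hn hm b α s hs
      exact ⟨j, w, hw, ⟨p, q, hpq, h⟩, borelEquiv_extendFrom 𝕜 hn hm _ _⟩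
    · rintro ⟨j, w, hw, ⟨p, q, hpq, h⟩, rfl⟩
      have hb : extendFrom 𝕜 (shuffleBorel 𝕜 w hw) j ∈ borelsWith 𝕜 α.vec :=
        ⟨_, simple_of_window hn hm hw hpq h⟩
      exact ⟨_, hb, borelEquiv_extendFrom 𝕜 hn hm _ _⟩
  · rintro α j w hw x ⟨p, q, hpq, h⟩ hx
    have hsgn := α.sgn_ne (w.injective.ne (by rintro rfl; omega)) h
    have ht := isTransposed_swap w hpq
    have hw' := isShuffle_swap hw hpq hsgn
    -- The reflected shuffle is `w` with the places `p` and `q` interchanged.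
    refine ⟨_, hw', ?_, ?_⟩
    · rw [h]
      exact reflect_finSimple hpq ht
    · have hb : extendFrom 𝕜 (shuffleBorel 𝕜 w hw) j ∈ borelsWith 𝕜 α.vec :=
        ⟨_, simple_of_window hn hm hw hpq h⟩
      have hadj := oddAdjacent_swap (𝕜 := 𝕜) hn hm hw hw' hpq h ht
      have hact := act_comp_symMap (oddFunctor 𝕜 hn hm) (borelEquiv 𝕜 hn hm) (rho α) x ⟨_, hb⟩
        ((borelEquiv_extendFrom 𝕜 hn hm _ _).trans hx.symm)
      rw [hact, act_oddFunctor hn hm α ⟨_, hb⟩ hadj, borelEquiv_extendFrom]
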